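/- Let $A$ and $B$ be finite-dimensional quantum systems. Let $\mathrm{CPTN}$ denote the completely positive trace-nonincreasing superoperators, and let $\mathrm{D}$ be the set of superoperators $\mathcal{E}=\mathcal{E}^+-\mathcal{E}^-$ with $\mathcal{E}^+,\mathcal{E}^-,\mathcal{E}^++\mathcal{E}^-\in\mathrm{CPTN}$. A signed instrument is a finite family $(\mathcal{E}_j)_j$ with $\mathcal{E}_j=\mathcal{E}_j^+-\mathcal{E}_j^-$, $\mathcal{E}_j^\pm\in\mathrm{CPTN}$ and $\sum_j(\mathcal{E}_j^++\mathcal{E}_j^-)\in\mathrm{CPTN}$. Let $\mathrm{LO}$ be the set of all products $\mathcal{A}\otimes\mathcal{B}$ with $\mathcal{A},\mathcal{B}\in\mathrm{D}$ acting on $A$ and $B$ respectively. Let $\mathrm{LO}\overrightarrow{\mathrm{CC}}$ be the set of all $\sum_j\mathcal{A}_j\otimes\mathcal{B}_j$, where $(\mathcal{A}_j)_j$ is a signed instrument on $A$ and every $\mathcal{B}_j$ is in $\mathrm{D}$ on $B$. Let $\mathrm{LOCC}$ be the set of all maps realized by protocols in which, in each round, one party applies a signed instrument to its system (whose dimension may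 change) and announces the outcome, all later operations may depend on all earlier outcomes, and the protocol ends with a map in $\mathrm{LO}$; the number of rounds is at most $R$, for an arbitrary fixed $R\in\{0,1,2,\dots\}\cup\{\infty\}$, where $R=\infty$ allows any finite number of rounds. For a set $S$ of superoperators on $A\otimes B$ and a unitary $U$ on $A\otimes B$, put $$\gamma_S(U)=\min\Big\{\sum_{i=1}^m|a_i| \;:\; U(\cdot)U^\dagger=\sum_{i=1}^m a_i\mathcal{F}_i,\ m\ge 1,\ \mathcal{F}_i\in S,\ a_i\in\mathbb{R}\Big\}.$$ **Theorem.** Let $U=(V_1\otimes V_2)\exp(\mathrm{i}\theta_X X\otimes X+\mathrm{i}\theta_Y Y\otimes Y+\mathrm{i}\theta_Z Z\otimes Z)(V_3\otimes V_4)$ be a two-qubit unitary, where $X,Y,Z$ are the Pauli matrices, $V_1,\dots,V_4$ are single-qubit unitaries and $\theta_X,\theta_Y,\theta_Z\in\mathbb{R}$. (Every two-qubit unitary has this form; this is its KAK decomposition.) Assume that $\theta_Z=0$ or $\theta_X=\theta_Y=\theta_Z=\pi/4$. Then, with respect to the cut between the two qubits, the minima defining $\gamma_{\mathrm{LO}}(U)$,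 $\gamma_{\mathrm{LO}\overrightarrow{\mathrm{CC}}}(U)$ and $\gamma_{\mathrm{LOCC}}(U)$ are attained, and $$\gamma_{\mathrm{LO}}(U)=\gamma_{\mathrm{LO}\overrightarrow{\mathrm{CC}}}(U)=\gamma_{\mathrm{LOCC}}(U)=1+4|\sin\theta_X\cos\theta_X|+4|\sin\theta_Y\cos\theta_Y|+8|\sin\theta_X\cos\theta_X\sin\theta_Y\cos\theta_Y|=2\Big(\sum_i\alpha_i\Big)^2-1,$$ where $\{\alpha_i\}_i$ are the Schmidt coefficients, across the cut $AA':BB'$, of the Choi state $(U_{AB}\otimes\mathbb{1}_{A'B'})(|\Psi\rangle_{AA'}\otimes|\Psi\rangle_{BB'})$ with $|\Psi\rangle=\frac{1}{\sqrt 2}(|00\rangle+|11\rangle)$. -/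

import Mathlib

open scoped Matrix Kronecker ComplexOrder

namespace CircuitKnitting

/-! ### Superoperators -/

/-- Linear superoperators: linear maps from operators on the space with basis `m`
to operators on the space with basis `n`. -/
abbrev Superop (m n : Type) : Type := Matrix m m ℂ →ₗ[ℂ] Matrix n n ℂ

/-- The tensor product `Φ ⊗ Ψ` of two superoperators: `Φ` is applied to the first tensor
factor of the argument and then `Ψ` to the second one. -/
def tensorMap {m n m' n' : Type} (Φ : Superop m m') (Ψ : Superop n n') :
    Superop (m × n) (m' × n') where
  toFun X := Matrix.of fun i j =>
    Ψ (Matrix.of fun r s => Φ (Matrix.of fun p q => X (p, r) (q, s)) i.1 j.1) i.2 j.2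
  map_add' X Y := by
    ext i j
    have h : ∀ r s, (Matrix.of fun p q => (X + Y) (p, r) (q, s)) =
        (Matrix.of fun p q => X (p, r) (q, s)) + Matrix.of fun p q => Y (p, r) (q, s) := by
      intro r s; ext p q; simp
    have h' : (Matrix.of fun r s => Φ (Matrix.of fun p q => (X + Y) (p, r) (q, s)) i.1 j.1) =
        (Matrix.of fun r s => Φ (Matrix.of fun p q => X (p, r) (q, s)) i.1 j.1) +
        Matrix.of fun r s => Φ (Matrix.of fun p q => Y (p, r) (q, s)) i.1 j.1 := by
      ext r s
      rw [Matrix.of_apply, h, map_add]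
      rfl
    rw [Matrix.of_apply, h', map_add]
    rfl
  map_smul' c X := by
    ext i j
    have h : ∀ r s, (Matrix.of fun p q => (c • X) (p, r) (q, s)) =
        c • Matrix.of fun p q => X (p, r) (q, s) := by
      intro r s; ext p q; simp
    have h' : (Matrix.of fun r s => Φ (Matrix.of fun p q => (c • X) (p, r) (q, s)) i.1 j.1) =
        c • Matrix.of fun r s => Φ (Matrix.of fun p q => X (p, r) (q, s)) i.1 j.1 := by
      ext r s
      rw [Matrix.of_apply, h, map_smul]
      rfl
    rw [Matrix.of_apply, h', map_smul]
    rfl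

/-- `tensorMap` is the tensor product: it acts factorwise on Kronecker products. -/
theorem tensorMap_kronecker {m n m' n' : Type} (Φ : Superop m m') (Ψ : Superop n n')
    (A : Matrix m m ℂ) (B : Matrix n n ℂ) :
    tensorMap Φ Ψ (A ⊗ₖ B) = Φ A ⊗ₖ Ψ B := by
  ext i j
  have h : ∀ r s, (Matrix.of fun p q => (A ⊗ₖ B) (p, r) (q, s)) = B r s • A := by
    intro r s; ext p q; simp [mul_comm]
  have h' : (Matrix.of fun r s => Φ (Matrix.of fun p q => (A ⊗ₖ B) (p, r) (q, s)) i.1 j.1) =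
      Φ A i.1 j.1 • B := by
    ext r s; simp only [h, map_smul, Matrix.of_apply, Matrix.smul_apply, smul_eq_mul, mul_comm]
  change Ψ (Matrix.of fun r s =>
    Φ (Matrix.of fun p q => (A ⊗ₖ B) (p, r) (q, s)) i.1 j.1) i.2 j.2 = _
  rw [h']
  simp

/-- Complete positivity: `id_k ⊗ Φ` maps positive semidefinite operators to positive
semidefinite operators, for every `k`. -/
def IsCP {m n : Type} (Φ : Superop m n) : Prop :=
  ∀ (k : ℕ) (X : Matrix (Fin k × m) (Fin k × m) ℂ), X.PosSemidef →
    (tensorMap (LinearMap.id : Superop (Fin k) (Fin k)) Φ X).PosSemidef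

/-- `Φ` does not increase the trace of positive semidefinite operators. -/
def IsTraceNonincreasing {m n : Type} [Fintype m] [Fintype n] (Φ : Superop m n) : Prop :=
  ∀ X : Matrix m m ℂ, X.PosSemidef → (Φ X).trace.re ≤ X.trace.re

/-- Completely positive trace-nonincreasing maps. -/
def IsCPTN {m n : Type} [Fintype m] [Fintype n] (Φ : Superop m n) : Prop :=
  IsCP Φ ∧ IsTraceNonincreasing Φ

/-- The class `D`: differences `Φ⁺ - Φ⁻` of completely positive trace-nonincreasing maps
whose sum `Φ⁺ + Φ⁻` is completely positive and trace-nonincreasing as well. -/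
def IsD {m n : Type} [Fintype m] [Fintype n] (Φ : Superop m n) : Prop :=
  ∃ Φp Φm : Superop m n, IsCPTN Φp ∧ IsCPTN Φm ∧ Φ = Φp - Φm ∧ IsCPTN (Φp + Φm)

/-- A finite-outcome quantum instrument in which every outcome also carries a sign used in the
classical post-processing: the map belonging to outcome `j` is `Φ j = Φ⁺ j - Φ⁻ j`, where all the
`Φ⁺ j` and `Φ⁻ j` together form a (trace-nonincreasing) instrument. For a single outcome this
is membership in `D`. -/
def IsSignedInstrument {m n : Type} [Fintype m] [Fintype n] {k : ℕ}
    (Φ : Fin k → Superop m n) : Prop :=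
  ∃ Φp Φm : Fin k → Superop m n,
    (∀ j, IsCPTN (Φp j) ∧ IsCPTN (Φm j) ∧ Φ j = Φp j - Φm j) ∧
      IsCPTN (∑ j, (Φp j + Φm j))

/-! ### Local operations, with and without classical communication

The input systems `A`, `B` have dimensions `a`, `b`, the output systems dimensions `a'`, `b'`. -/

/-- Local operations: products of a map in `D` on `A` and a map in `D` on `B`. -/
def LO (a b a' b' : ℕ) : Set (Superop (Fin a × Fin b) (Fin a' × Fin b')) :=
  {F | ∃ (𝒜 : Superop (Fin a) (Fin a')) (ℬ : Superop (Fin b) (Fin b')),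
    IsD 𝒜 ∧ IsD ℬ ∧ F = tensorMap 𝒜 ℬ}

/-- Local operations and one-way classical communication from `A` to `B`: `A` applies an
instrument and sends its outcome `j` to `B`, who applies a local operation depending on `j`. -/
def LOOneWayCC (a b a' b' : ℕ) : Set (Superop (Fin a × Fin b) (Fin a' × Fin b')) :=
  {F | ∃ (k : ℕ) (𝒜 : Fin k → Superop (Fin a) (Fin a')) (ℬ : Fin k → Superop (Fin b) (Fin b')),
    IsSignedInstrument 𝒜 ∧ (∀ j, IsD (ℬ j)) ∧ F = ∑ j, tensorMap (𝒜 j) (ℬ j)}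

/-- LOCC protocols with `r` rounds of classical communication. Without communication these are
the local operations. In a round, one of the parties applies an instrument to its system (whose
dimension may change, e.g. because local ancillas are added) and announces the outcome `j`; after
that, the parties continue with a protocol with one round less, which may depend on `j` and
hence, in the course of the protocol, on all the earlier messages. -/
def LOCCRounds : ℕ → (a b a' b' : ℕ) → Set (Superop (Fin a × Fin b) (Fin a' × Fin b'))
  | 0, a, b, a', b' => LO a b a' b'
  | r + 1, a, b, a', b' =>
    {F | ∃ (k c : ℕ) (𝒜 : Fin k → Superop (Fin a) (Fin c))
        (G : Fin k → Superop (Fin c × Fin b) (Fin a' × Fin b')),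
      IsSignedInstrument 𝒜 ∧ (∀ j, G j ∈ LOCCRounds r c b a' b') ∧
        F = ∑ j, G j ∘ₗ tensorMap (𝒜 j) LinearMap.id} ∪
    {F | ∃ (k c : ℕ) (ℬ : Fin k → Superop (Fin b) (Fin c))
        (G : Fin k → Superop (Fin a × Fin c) (Fin a' × Fin b')),
      IsSignedInstrument ℬ ∧ (∀ j, G j ∈ LOCCRounds r a c a' b') ∧
        F = ∑ j, G j ∘ₗ tensorMap LinearMap.id (ℬ j)}

/-- LOCC maps realized with at most `R` rounds of communication; for `R = ⊤` the number of
rounds is finite but arbitrary. -/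
def LOCC (R : ℕ∞) (a b a' b' : ℕ) : Set (Superop (Fin a × Fin b) (Fin a' × Fin b')) :=
  {F | ∃ r : ℕ, (r : ℕ∞) ≤ R ∧ F ∈ LOCCRounds r a b a' b'}

/-! ### The γ-factor -/

/-- The one-norms `∑ i, |a i|` of all quasiprobability decompositions `E = ∑ i, a i • F i` with
real coefficients and with `F i` in the set `S` of available operations. -/
def qpdCosts {m n : Type} (S : Set (Superop m n)) (E : Superop m n) : Set ℝ :=
  {κ | ∃ N : ℕ, 1 ≤ N ∧ ∃ (a : Fin N → ℝ) (F : Fin N → Superop m n),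
    (∀ i, F i ∈ S) ∧ E = ∑ i, (a i : ℂ) • F i ∧ κ = ∑ i, |a i|}

/-- The γ-factor of `E` over `S`: the smallest one-norm of a quasiprobability decomposition. -/
noncomputable def gammaFactor {m n : Type} (S : Set (Superop m n)) (E : Superop m n) : ℝ :=
  sInf (qpdCosts S E)

/-- The channel `X ↦ U X Uᴴ` induced by `U`. -/
def unitaryChannel {n : Type} [Fintype n] (U : Matrix n n ℂ) : Superop n n where
  toFun X := U * X * Uᴴ
  map_add' X Y := by rw [mul_add, add_mul]
  map_smul' c X := by simp

/-! ### KAK decomposition -/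

/-- The Pauli matrix `X`. -/
def pauliX : Matrix (Fin 2) (Fin 2) ℂ := !![0, 1; 1, 0]

/-- The Pauli matrix `Y`. -/
def pauliY : Matrix (Fin 2) (Fin 2) ℂ := !![0, -Complex.I; Complex.I, 0]

/-- The Pauli matrix `Z`. -/
def pauliZ : Matrix (Fin 2) (Fin 2) ℂ := !![1, 0; 0, -1]

/-- `U = (V₁ ⊗ V₂) exp(iθ_X X⊗X + iθ_Y Y⊗Y + iθ_Z Z⊗Z) (V₃ ⊗ V₄)` for some single-qubit
unitaries `V₁, V₂, V₃, V₄`. -/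
def HasKAKAngles (U : Matrix (Fin 2 × Fin 2) (Fin 2 × Fin 2) ℂ) (θX θY θZ : ℝ) : Prop :=
  ∃ V₁ V₂ V₃ V₄ : Matrix (Fin 2) (Fin 2) ℂ,
    V₁ ∈ Matrix.unitaryGroup (Fin 2) ℂ ∧ V₂ ∈ Matrix.unitaryGroup (Fin 2) ℂ ∧
    V₃ ∈ Matrix.unitaryGroup (Fin 2) ℂ ∧ V₄ ∈ Matrix.unitaryGroup (Fin 2) ℂ ∧
    U = (V₁ ⊗ₖ V₂) *
      NormedSpace.exp ((Complex.I * (θX : ℂ)) • (pauliX ⊗ₖ pauliX) +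
        (Complex.I * (θY : ℂ)) • (pauliY ⊗ₖ pauliY) +
        (Complex.I * (θZ : ℂ)) • (pauliZ ⊗ₖ pauliZ)) *
      (V₃ ⊗ₖ V₄)

/-! ### Choi state and Schmidt coefficients -/

/-- The maximally entangled state `(1/√d) ∑ i, |i⟩|i⟩` of two `d`-dimensional systems. -/
noncomputable def maxEntangled (d : ℕ) : Fin d × Fin d → ℂ :=
  fun i => if i.1 = i.2 then ((1 / Real.sqrt d : ℝ) : ℂ) else 0

/-- The Choi state `(U_AB ⊗ 1_A'B') (|Ψ⟩_AA' ⊗ |Ψ⟩_BB')`; its coordinates are indexed by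
`((A, A'), (B, B'))`. -/
noncomputable def choiState {a b : ℕ} (U : Matrix (Fin a × Fin b) (Fin a × Fin b) ℂ) :
    (Fin a × Fin a) × (Fin b × Fin b) → ℂ :=
  fun x => ∑ p : Fin a × Fin b, U (x.1.1, x.2.1) p *
    (maxEntangled a (p.1, x.1.2) * maxEntangled b (p.2, x.2.2))

/-- `ψ = ∑ i, α i • (e i ⊗ f i)` is a Schmidt decomposition of the bipartite vector `ψ`, with
Schmidt coefficients `α i ≥ 0` and orthonormal families `e` and `f`. -/
def IsSchmidtDecomposition {m n : Type} [Fintype m] [Fintype n] {k : ℕ} (ψ : m × n → ℂ)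
    (α : Fin k → ℝ) (e : Fin k → EuclideanSpace ℂ m) (f : Fin k → EuclideanSpace ℂ n) : Prop :=
  (∀ i, 0 ≤ α i) ∧ Orthonormal ℂ e ∧ Orthonormal ℂ f ∧
    ∀ x y, ψ (x, y) = ∑ i, (α i : ℂ) * (e i x * f i y)

end CircuitKnitting

/-! The KAK form gives `U` an operator-Schmidt decomposition `U = ∑ u i • (L i ⊗ R i)` with `u i ≥
0`, `∑ u i ^ 2 = 1` and all `L i`, `R i` unitary. The exponential is a combination of the four `σ_i
⊗ σ_i`, whose phases go into `L i`. For any such `U` all three γ-factors equal `2 (∑ u i)² - 1`; the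
condition on the angles serves only to put this number in closed form.

Lower bound (`norm_dualWitness_le`, `HasUnitarySchmidt.dualWitness_eq`): LO, one-way and LOCC maps
are all signed sums of products of completely positive maps with controlled total trace. A linear
functional built from a maximally entangled vector is at most 4 in modulus on these and equals `4 (2
(∑ u i)² - 1)` on the channel of `U`.

Upper bound (`HasUnitarySchmidt.mem_qpdCosts_LO`): expanding `U X Uᴴ` in pairs `(i, j)` and
symmetrising in `i ↔ j` writes the channel in products of local maps in `D`. The cost is `∑ u i u j`
over all pairs plus the same sum over `i ≠ j`, that is `2 (∑ u i)² - 1`.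

The `u i` are Schmidt coefficients of the Choi state, and the sum of Schmidt coefficients does not
depend on the decomposition (`IsSchmidtDecomposition.sum_le`). -/

namespace CircuitKnitting

/-! ### Bilinearity and functoriality of the tensor product of superoperators -/

section TensorMap

variable {m n m' n' : Type}

/-- Matrix units of the product space are Kronecker products of matrix units. Identities between
bipartite superoperators thus reduce to `tensorMap_kronecker`. -/
theorem superop_ext_kronecker [Finite m] [Finite n] {k : Type} {F G : Superop (m × n) k}
    (h : ∀ (A : Matrix m m ℂ) (B : Matrix n n ℂ), F (A ⊗ₖ B) = G (A ⊗ₖ B)) : F = G := by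
  classical
  refine Matrix.ext_linearMap ℂ fun i j => ?_
  ext1
  have := h (Matrix.single i.1 j.1 1) (Matrix.single i.2 j.2 1)
  rw [Matrix.single_kronecker_single, mul_one] at this
  simpa using this

theorem tensorMap_id_comp {k l : Type} (Φ : Superop m n) (Ψ : Superop n l) :
    tensorMap (LinearMap.id : Superop k k) (Ψ ∘ₗ Φ) =
      tensorMap LinearMap.id Ψ ∘ₗ tensorMap LinearMap.id Φ := by
  ext X i j
  rfl

theorem isCP_comp {l : Type} {Φ : Superop m n} {Ψ : Superop n l} (hΨ : IsCP Ψ) (hΦ : IsCP Φ) :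
    IsCP (Ψ ∘ₗ Φ) := by
  intro k X hX
  rw [tensorMap_id_comp]
  exact hΨ k _ (hΦ k X hX)

theorem isCP_id : IsCP (LinearMap.id : Superop m m) := fun _ _ hX => hX

theorem IsCP.posSemidef {Φ : Superop m n} (hΦ : IsCP Φ) {X : Matrix m m ℂ} (hX : X.PosSemidef) :
    (Φ X).PosSemidef := by
  have h := hΦ 1 (X.submatrix Prod.snd Prod.snd) (hX.submatrix _)
  exact h.submatrix fun i : n => ((0 : Fin 1), i)

theorem IsCP.trace_nonneg [Fintype n] {Φ : Superop m n} (hΦ : IsCP Φ) {X : Matrix m m ℂ}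
    (hX : X.PosSemidef) : 0 ≤ (Φ X).trace.re :=
  (Complex.nonneg_iff.1 (hΦ.posSemidef hX).trace_nonneg).1

theorem IsCP.zero : IsCP (0 : Superop m n) := by
  intro k X _
  have : tensorMap (LinearMap.id : Superop (Fin k) (Fin k)) (0 : Superop m n) X = 0 := by
    ext i j; rfl
  rw [this]
  exact Matrix.PosSemidef.zero

theorem isD_id [Fintype m] : IsD (LinearMap.id : Superop m m) :=
  ⟨LinearMap.id, 0, ⟨isCP_id, fun _ _ => le_rfl⟩,
    ⟨IsCP.zero, fun X hX => by simpa using (Complex.nonneg_iff.1 hX.trace_nonneg).1⟩, by simp,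
    by rw [add_zero]; exact ⟨isCP_id, fun _ _ => le_rfl⟩⟩

end TensorMap

/-! ### Signed separable superoperators -/

/-- Signed sums of products of completely positive maps whose total weight does not increase the
trace of product operators. -/
def IsSignedSeparable {m n m' n' : Type} [Fintype m] [Fintype n] [Fintype m'] [Fintype n']
    (F : Superop (m × n) (m' × n')) : Prop :=
  ∃ (ι : Type) (_ : Fintype ι) (s : ι → ℝ) (A : ι → Superop m m') (B : ι → Superop n n'),
    (∀ i, |s i| ≤ 1) ∧ (∀ i, IsCP (A i)) ∧ (∀ i, IsCP (B i)) ∧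
    F = ∑ i, (s i : ℂ) • tensorMap (A i) (B i) ∧
    ∀ (ρ : Matrix m m ℂ) (σ : Matrix n n ℂ), ρ.PosSemidef → σ.PosSemidef →
      ∑ i, (A i ρ).trace.re * (B i σ).trace.re ≤ ρ.trace.re * σ.trace.re

/-- The sign attached to the positive (`true`) or negative (`false`) part. -/
def boolSign (t : Bool) : ℝ := if t then 1 else -1

theorem abs_boolSign (t : Bool) : |boolSign t| = 1 := by cases t <;> simp [boolSign]

section Separable

variable {m n m' n' c : Type} [Fintype m] [Fintype n] [Fintype m'] [Fintype n'] [Fintype c]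

theorem IsD.exists_signed {Φ : Superop m n} (h : IsD Φ) :
    ∃ P : Bool → Superop m n, (∀ t, IsCP (P t)) ∧ Φ = ∑ t, (boolSign t : ℂ) • P t ∧
      ∀ X : Matrix m m ℂ, X.PosSemidef → ∑ t, (P t X).trace.re ≤ X.trace.re := by
  obtain ⟨p, q, hp, hq, rfl, hpq⟩ := h
  refine ⟨fun t => if t then p else q, ?_, ?_, ?_⟩
  · rintro (_ | _)
    exacts [hq.1, hp.1]
  · simp only [boolSign, Fintype.sum_bool]
    simp [sub_eq_add_neg]
    exact (neg_one_smul ℂ _).symm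
  · intro X hX
    simpa using hpq.2 X hX

theorem IsSignedInstrument.exists_signed {k : ℕ} {Φ : Fin k → Superop m n}
    (h : IsSignedInstrument Φ) :
    ∃ P : Fin k → Bool → Superop m n, (∀ j t, IsCP (P j t)) ∧
      (∀ j, Φ j = ∑ t, (boolSign t : ℂ) • P j t) ∧
      ∀ X : Matrix m m ℂ, X.PosSemidef → ∑ j, ∑ t, (P j t X).trace.re ≤ X.trace.re := by
  obtain ⟨p, q, hpq, hs⟩ := h
  refine ⟨fun j t => if t then p j else q j, ?_, ?_, ?_⟩
  · rintro j (_ | _)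
    exacts [(hpq j).2.1.1, (hpq j).1.1]
  · intro j
    rw [(hpq j).2.2]
    simp [boolSign, sub_eq_add_neg]
    exact (neg_one_smul ℂ _).symm
  · intro X hX
    have := hs.2 X hX
    simpa [Matrix.trace_sum] using this

theorem isSignedSeparable_tensorMap {A : Superop m m'} {B : Superop n n'} (hA : IsD A)
    (hB : IsD B) : IsSignedSeparable (tensorMap A B) := by
  obtain ⟨P, hP, rfl, hPt⟩ := hA.exists_signed
  obtain ⟨Q, hQ, rfl, hQt⟩ := hB.exists_signed
  refine ⟨Bool × Bool, inferInstance, fun t => boolSign t.1 * boolSign t.2, fun t => P t.1,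
    fun t => Q t.2, fun t => by simp [abs_mul, abs_boolSign], fun t => hP _, fun t => hQ _, ?_, ?_⟩
  · refine superop_ext_kronecker fun X Y => ?_
    ext i j
    simp only [tensorMap_kronecker, LinearMap.sum_apply, LinearMap.smul_apply,
      Matrix.kroneckerMap_apply, Matrix.sum_apply, Matrix.smul_apply, Fintype.sum_prod_type,
      Finset.sum_mul_sum, smul_eq_mul, Complex.ofReal_mul]
    exact Finset.sum_congr rfl fun _ _ => Finset.sum_congr rfl fun _ _ => by ring
  · intro ρ σ hρ hσ
    simp only [Fintype.sum_prod_type, ← Finset.sum_mul_sum]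
    exact mul_le_mul (hPt ρ hρ) (hQt σ hσ) (Finset.sum_nonneg fun t _ => (hQ t).trace_nonneg hσ)
      (Complex.nonneg_iff.1 hρ.trace_nonneg).1

/-- The completely positive parts of the instrument are absorbed into the left factors of the later
maps. The trace condition composes because it is required only on product operators: each later map
is tested on `P j t ρ` and `σ`, and the instrument bounds the sum of the traces of the `P j t ρ`. -/
theorem isSignedSeparable_round_left {k : ℕ} {A : Fin k → Superop m c}
    {G : Fin k → Superop (c × n) (m' × n')} (hA : IsSignedInstrument A)
    (hG : ∀ j, IsSignedSeparable (G j)) :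
    IsSignedSeparable (∑ j, G j ∘ₗ tensorMap (A j) LinearMap.id) := by
  obtain ⟨P, hP, hPA, hPt⟩ := hA.exists_signed
  choose ι _ s C D hs hC hD hCD ht using hG
  refine ⟨(j : Fin k) × (Bool × ι j), inferInstance, fun x => boolSign x.2.1 * s x.1 x.2.2,
    fun x => C x.1 x.2.2 ∘ₗ P x.1 x.2.1, fun x => D x.1 x.2.2,
    fun x => by simpa [abs_mul, abs_boolSign] using hs _ _, fun x => isCP_comp (hC _ _) (hP _ _),
    fun x => hD _ _, ?_, ?_⟩
  · refine superop_ext_kronecker fun X Y => ?_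
    ext i j
    simp only [LinearMap.sum_apply, LinearMap.comp_apply, tensorMap_kronecker, LinearMap.id_apply,
      hCD, hPA, LinearMap.smul_apply, Matrix.sum_apply, Matrix.smul_apply, map_sum, map_smul,
      Matrix.kroneckerMap_apply, Fintype.sum_sigma, Fintype.sum_prod_type, smul_eq_mul,
      Complex.ofReal_mul, Finset.sum_mul, Finset.mul_sum]
    refine Finset.sum_congr rfl fun a _ => ?_
    rw [Finset.sum_comm]
    exact Finset.sum_congr rfl fun _ _ => Finset.sum_congr rfl fun _ _ => by ring
  · intro ρ σ hρ hσ
    simp only [Fintype.sum_sigma, Fintype.sum_prod_type, LinearMap.comp_apply]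
    refine (Finset.sum_le_sum fun j _ => Finset.sum_le_sum fun t _ =>
      ht j _ σ ((hP j t).posSemidef hρ) hσ).trans ?_
    simp only [← Finset.sum_mul]
    exact mul_le_mul_of_nonneg_right (hPt ρ hρ) (Complex.nonneg_iff.1 hσ.trace_nonneg).1

theorem isSignedSeparable_round_right {k : ℕ} {B : Fin k → Superop n c}
    {G : Fin k → Superop (m × c) (m' × n')} (hB : IsSignedInstrument B)
    (hG : ∀ j, IsSignedSeparable (G j)) :
    IsSignedSeparable (∑ j, G j ∘ₗ tensorMap LinearMap.id (B j)) := by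
  obtain ⟨P, hP, hPB, hPt⟩ := hB.exists_signed
  choose ι _ s C D hs hC hD hCD ht using hG
  refine ⟨(j : Fin k) × (Bool × ι j), inferInstance, fun x => boolSign x.2.1 * s x.1 x.2.2,
    fun x => C x.1 x.2.2, fun x => D x.1 x.2.2 ∘ₗ P x.1 x.2.1,
    fun x => by simpa [abs_mul, abs_boolSign] using hs _ _, fun x => hC _ _,
    fun x => isCP_comp (hD _ _) (hP _ _), ?_, ?_⟩
  · refine superop_ext_kronecker fun X Y => ?_
    ext i j
    simp only [LinearMap.sum_apply, LinearMap.comp_apply, tensorMap_kronecker, LinearMap.id_apply,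
      hCD, hPB, LinearMap.smul_apply, Matrix.sum_apply, Matrix.smul_apply, map_sum, map_smul,
      Matrix.kroneckerMap_apply, Fintype.sum_sigma, Fintype.sum_prod_type, smul_eq_mul,
      Complex.ofReal_mul, Finset.mul_sum]
    refine Finset.sum_congr rfl fun a _ => ?_
    rw [Finset.sum_comm]
    exact Finset.sum_congr rfl fun _ _ => Finset.sum_congr rfl fun _ _ => by ring
  · intro ρ σ hρ hσ
    simp only [Fintype.sum_sigma, Fintype.sum_prod_type, LinearMap.comp_apply]
    refine (Finset.sum_le_sum fun j _ => Finset.sum_le_sum fun t _ =>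
      ht j ρ _ hρ ((hP j t).posSemidef hσ)).trans ?_
    simp only [← Finset.mul_sum]
    exact mul_le_mul_of_nonneg_left (hPt σ hσ) (Complex.nonneg_iff.1 hρ.trace_nonneg).1

end Separable

theorem isSignedSeparable_of_mem_LO {a b a' b' : ℕ}
    {F : Superop (Fin a × Fin b) (Fin a' × Fin b')} (hF : F ∈ LO a b a' b') :
    IsSignedSeparable F := by
  obtain ⟨A, B, hA, hB, rfl⟩ := hF
  exact isSignedSeparable_tensorMap hA hB

/-- Each term factors as `(id ⊗ B j) ∘ (A j ⊗ id)`, a single round followed by a local operation. -/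
theorem isSignedSeparable_of_mem_LOOneWayCC {a b a' b' : ℕ}
    {F : Superop (Fin a × Fin b) (Fin a' × Fin b')} (hF : F ∈ LOOneWayCC a b a' b') :
    IsSignedSeparable F := by
  obtain ⟨k, A, B, hA, hB, rfl⟩ := hF
  have h := isSignedSeparable_round_left hA fun j =>
    isSignedSeparable_tensorMap (isD_id (m := Fin a')) (hB j)
  convert h using 3 with j
  exact superop_ext_kronecker fun X Y => by simp [tensorMap_kronecker]

theorem isSignedSeparable_of_mem_LOCCRounds {r a b a' b' : ℕ}
    {F : Superop (Fin a × Fin b) (Fin a' × Fin b')} (hF : F ∈ LOCCRounds r a b a' b') :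
    IsSignedSeparable F := by
  induction r generalizing a b with
  | zero => exact isSignedSeparable_of_mem_LO hF
  | succ r ih =>
    rcases hF with ⟨k, c, A, G, hA, hG, rfl⟩ | ⟨k, c, B, G, hB, hG, rfl⟩
    · exact isSignedSeparable_round_left hA fun j => ih (hG j)
    · exact isSignedSeparable_round_right hB fun j => ih (hG j)

theorem LO_subset_LOOneWayCC (a b a' b' : ℕ) : LO a b a' b' ⊆ LOOneWayCC a b a' b' := by
  rintro _ ⟨A, B, ⟨p, q, hp, hq, hA, hpq⟩, hB, rfl⟩
  exact ⟨1, fun _ => A, fun _ => B,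
    ⟨fun _ => p, fun _ => q, fun _ => ⟨hp, hq, hA⟩, by simpa using hpq⟩, fun _ => hB, by simp⟩

theorem LO_subset_LOCC (R : ℕ∞) (a b a' b' : ℕ) : LO a b a' b' ⊆ LOCC R a b a' b' :=
  fun _ hF => ⟨0, by simp, hF⟩

/-! ### The dual bound -/

/-- In an eigenbasis of `P` the trace is the sum of eigenvalues of `P` times diagonal entries of the
rotated `Q`. Each such entry lies between 0 and `Q.trace`. -/
theorem trace_mul_posSemidef {ι : Type} [Fintype ι] {P Q : Matrix ι ι ℂ}
    (hP : P.PosSemidef) (hQ : Q.PosSemidef) :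
    0 ≤ (P * Q).trace ∧ (P * Q).trace ≤ P.trace * Q.trace := by
  classical
  set V : Matrix ι ι ℂ := (hP.1.eigenvectorUnitary : Matrix ι ι ℂ) with hV
  have hVV : V * Vᴴ = 1 := Matrix.mem_unitaryGroup_iff.1 hP.1.eigenvectorUnitary.2
  set d : ι → ℂ := fun i => (hP.1.eigenvalues i : ℂ) with hd
  have hd0 : ∀ i, 0 ≤ d i := fun i => by
    simpa [hd] using hP.eigenvalues_nonneg i
  have hPd : P = V * Matrix.diagonal d * Vᴴ := by
    conv_lhs => rw [hP.1.spectral_theorem, Unitary.conjStarAlgAut_apply]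
    rfl
  set Q' := Vᴴ * Q * V with hQ'
  have hQ'p : Q'.PosSemidef := hQ.conjTranspose_mul_mul_same V
  have hq0 : ∀ i, 0 ≤ Q' i i := fun i => hQ'p.diag_nonneg
  have htr : (P * Q).trace = ∑ i, d i * Q' i i := by
    have : (P * Q).trace = (Matrix.diagonal d * Q').trace := by
      rw [hPd, hQ', Matrix.mul_assoc, Matrix.mul_assoc, Matrix.trace_mul_comm]
      simp only [Matrix.mul_assoc]
    rw [this, Matrix.trace]
    simp [Matrix.diagonal_mul]
  have hQt : Q.trace = ∑ i, Q' i i := by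
    change _ = Q'.trace
    rw [hQ', Matrix.trace_mul_cycle, hVV, Matrix.one_mul]
  have hPt : P.trace = ∑ i, d i := hP.1.trace_eq_sum_eigenvalues
  rw [htr, hQt, hPt]
  refine ⟨Finset.sum_nonneg fun i _ => mul_nonneg (hd0 i) (hq0 i), ?_⟩
  rw [Finset.sum_mul]
  exact Finset.sum_le_sum fun i _ => mul_le_mul_of_nonneg_left
    (Finset.single_le_sum (fun j _ => hq0 j) (Finset.mem_univ i)) (hd0 i)

/-- The (unnormalised) Choi matrix of a superoperator. -/
def choiMatrix {m n : Type} [DecidableEq m] (Φ : Superop m n) : Matrix (m × n) (m × n) ℂ :=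
  Matrix.of fun x y => Φ (Matrix.single x.1 y.1 1) x.2 y.2

/-- The Choi matrix is the image under `id ⊗ Φ` of the unnormalised maximally entangled projector,
with an ancilla as large as the input. -/
theorem IsCP.choiMatrix_posSemidef {k : ℕ} {n : Type} {Φ : Superop (Fin k) n} (hΦ : IsCP Φ) :
    (choiMatrix Φ).PosSemidef := by
  let w : Fin k × Fin k → ℂ := fun p => if p.1 = p.2 then 1 else 0
  have h := hΦ k _ (Matrix.posSemidef_vecMulVec_self_star w)
  convert h using 1
  ext x y
  have hs : Matrix.single x.1 y.1 1 =
      Matrix.of fun r s => Matrix.vecMulVec w (star w) (x.1, r) (y.1, s) := by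
    ext r s
    simp [w, Matrix.single_apply, Matrix.vecMulVec_apply]
    grind
  change Φ (Matrix.single x.1 y.1 1) x.2 y.2 = _
  rw [hs]
  rfl

theorem trace_choiMatrix {m n : Type} [Fintype m] [Fintype n] [DecidableEq m] (Φ : Superop m n) :
    (choiMatrix Φ).trace = (Φ 1).trace := by
  have h1 : (1 : Matrix m m ℂ) = ∑ i, Matrix.single i i 1 := by
    ext i j
    rw [Matrix.sum_apply]
    simp only [Matrix.single_apply, Matrix.one_apply]
    by_cases h : i = j
    · subst h
      simp
    · rw [if_neg h, Finset.sum_eq_zero]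
      grind
  rw [h1, map_sum, Matrix.trace_sum, Matrix.trace, Fintype.sum_prod_type]
  rfl

section Dual

variable {m n m' n' : Type} [DecidableEq m] [DecidableEq n]

/-- The Choi matrix of a bipartite superoperator, with the systems grouped by party. -/
def bipartiteChoi (F : Superop (m × n) (m' × n')) :
    Matrix ((m × m') × (n × n')) ((m × m') × (n × n')) ℂ :=
  Matrix.of fun x y =>
    F (Matrix.single (x.1.1, x.2.1) (y.1.1, y.2.1) 1) (x.1.2, x.2.2) (y.1.2, y.2.2)

theorem bipartiteChoi_tensorMap (A : Superop m m') (B : Superop n n') :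
    bipartiteChoi (tensorMap A B) = choiMatrix A ⊗ₖ choiMatrix B := by
  ext x y
  have := tensorMap_kronecker A B (Matrix.single x.1.1 y.1.1 1) (Matrix.single x.2.1 y.2.1 1)
  rw [Matrix.single_kronecker_single, mul_one] at this
  simp [bipartiteChoi, choiMatrix, this]

variable [Fintype m] [Fintype n] [Fintype m'] [Fintype n']

/-- The dual witness `F ↦ 2 ⟨φ|C(F)|φ⟩ - tr F(1)`, with `φ` the vectorisation of `W`. -/
def dualWitness (W : Matrix (n × n') (m × m') ℂ) : Superop (m × n) (m' × n') →ₗ[ℂ] ℂ where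
  toFun F := 2 * (star W.vec ⬝ᵥ (bipartiteChoi F *ᵥ W.vec)) - (F 1).trace
  map_add' F G := by
    have : bipartiteChoi (F + G) = bipartiteChoi F + bipartiteChoi G := rfl
    simp only [this, Matrix.add_mulVec, dotProduct_add, LinearMap.add_apply, Matrix.trace_add]
    ring
  map_smul' c F := by
    have : bipartiteChoi (c • F) = c • bipartiteChoi F := rfl
    simp only [this, Matrix.smul_mulVec, dotProduct_smul, LinearMap.smul_apply, Matrix.trace_smul,
      smul_eq_mul, RingHom.id_apply]
    ring

end Dual

section Bound

variable {a b a' b' : ℕ} {W : Matrix (Fin b × Fin b') (Fin a × Fin a') ℂ}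

/-- The quadratic form is `tr (Wᴴ C_B W C_Aᵀ)`, a trace of a product of positive semidefinite
matrices. As `W` is unitary it lies in `[0, tr C_A * tr C_B]`; doubling and subtracting `tr A(1) *
tr B(1)` centres this interval at 0. -/
theorem norm_dualWitness_tensorMap_le (hW : W * Wᴴ = 1) {A : Superop (Fin a) (Fin a')}
    {B : Superop (Fin b) (Fin b')} (hA : IsCP A) (hB : IsCP B) :
    ‖dualWitness W (tensorMap A B)‖ ≤ (A 1).trace.re * (B 1).trace.re := by
  have hCA := hA.choiMatrix_posSemidef
  have hCB := hB.choiMatrix_posSemidef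
  have h := trace_mul_posSemidef (hCB.conjTranspose_mul_mul_same W) hCA.transpose
  rw [Matrix.trace_mul_cycle Wᴴ, hW, Matrix.one_mul, Matrix.trace_transpose, trace_choiMatrix,
    trace_choiMatrix] at h
  have hA0 := Complex.nonneg_iff.1 (hA.posSemidef Matrix.PosSemidef.one).trace_nonneg
  have hB0 := Complex.nonneg_iff.1 (hB.posSemidef Matrix.PosSemidef.one).trace_nonneg
  have hval : dualWitness W (tensorMap A B) =
      2 * (Wᴴ * choiMatrix B * W * (choiMatrix A)ᵀ).trace - (A 1).trace * (B 1).trace := by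
    change 2 * (star W.vec ⬝ᵥ (bipartiteChoi (tensorMap A B) *ᵥ W.vec)) -
      (tensorMap A B 1).trace = _
    rw [bipartiteChoi_tensorMap, Matrix.kronecker_mulVec_vec, Matrix.star_vec_dotProduct_vec,
      ← Matrix.one_kronecker_one, tensorMap_kronecker, Matrix.trace_kronecker]
    simp only [Matrix.mul_assoc]
  rw [hval]
  generalize (Wᴴ * choiMatrix B * W * (choiMatrix A)ᵀ).trace = w at h
  obtain ⟨h0, h1⟩ := h
  have hw := Complex.nonneg_iff.1 h0
  have h2 := Complex.le_def.1 h1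
  have hA' : (A 1).trace = ((A 1).trace.re : ℂ) := Complex.ext rfl (by simp [← hA0.2])
  have hB' : (B 1).trace = ((B 1).trace.re : ℂ) := Complex.ext rfl (by simp [← hB0.2])
  have hw' : w = (w.re : ℂ) := Complex.ext rfl (by simp [← hw.2])
  rw [hA', hB'] at h2 ⊢
  rw [hw'] at h2 ⊢
  rw [← Complex.ofReal_mul] at h2 ⊢
  have h3 := h2.1
  simp only [mul_comm, Complex.ofReal_re] at h3
  have : (2 * (w.re : ℂ) - (((A 1).trace.re * (B 1).trace.re : ℝ) : ℂ)) =
    ((2 * w.re - (A 1).trace.re * (B 1).trace.re : ℝ) : ℂ) := by push_cast; ring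
  rw [this, Complex.norm_real, Real.norm_eq_abs, abs_le]
  simp only [Complex.ofReal_re]
  constructor <;> linarith [hw.1]

theorem norm_dualWitness_le (hW : W * Wᴴ = 1) {F : Superop (Fin a × Fin b) (Fin a' × Fin b')}
    (hF : IsSignedSeparable F) : ‖dualWitness W F‖ ≤ a * b := by
  obtain ⟨ι, _, s, A, B, hs, hA, hB, rfl, ht⟩ := hF
  rw [map_sum]
  refine (norm_sum_le _ _).trans ?_
  refine (Finset.sum_le_sum (g := fun i => (A i 1).trace.re * (B i 1).trace.re)
    fun i _ => ?_).trans ?_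
  · rw [map_smul, norm_smul, Complex.norm_real, Real.norm_eq_abs]
    refine (mul_le_of_le_one_left (norm_nonneg _) (hs i)).trans ?_
    exact norm_dualWitness_tensorMap_le hW (hA i) (hB i)
  -- The trace condition at the two identities, whose traces `a` and `b` give the constant.
  · simpa using ht 1 1 Matrix.PosSemidef.one Matrix.PosSemidef.one

theorem norm_dualWitness_le_of_mem_qpdCosts (hW : W * Wᴴ = 1)
    {S : Set (Superop (Fin a × Fin b) (Fin a' × Fin b'))} (hS : ∀ F ∈ S, IsSignedSeparable F)
    {E : Superop (Fin a × Fin b) (Fin a' × Fin b')} {κ : ℝ} (hκ : κ ∈ qpdCosts S E) :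
    ‖dualWitness W E‖ ≤ κ * (a * b) := by
  obtain ⟨N, -, c, F, hF, rfl, rfl⟩ := hκ
  rw [map_sum, Finset.sum_mul]
  refine (norm_sum_le _ _).trans (Finset.sum_le_sum fun i _ => ?_)
  rw [map_smul, norm_smul, Complex.norm_real, Real.norm_eq_abs]
  exact mul_le_mul_of_nonneg_left (norm_dualWitness_le hW (hS _ (hF i))) (abs_nonneg _)

end Bound

/-! ### Operators with a Schmidt decomposition into unitaries -/

/-- `U = ∑ i, u i • (L i ⊗ R i)` with `u i ≥ 0`, `∑ i, u i ^ 2 = 1` and with unitary operators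
`L i` and `R i`, both families being orthogonal for the Hilbert–Schmidt inner product. -/
structure HasUnitarySchmidt (U : Matrix (Fin 2 × Fin 2) (Fin 2 × Fin 2) ℂ) (u : Fin 4 → ℝ)
    (L R : Fin 4 → Matrix (Fin 2) (Fin 2) ℂ) : Prop where
  nonneg : ∀ i, 0 ≤ u i
  sum_sq : ∑ i, u i ^ 2 = 1
  left_unitary : ∀ i, (L i)ᴴ * L i = 1
  right_unitary : ∀ i, (R i)ᴴ * R i = 1
  left_orthogonal : ∀ i j, ((L i)ᴴ * L j).trace = if i = j then 2 else 0
  right_orthogonal : ∀ i j, ((R i)ᴴ * R j).trace = if i = j then 2 else 0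
  eq_sum : U = ∑ i, (u i : ℂ) • (L i ⊗ₖ R i)

/-- The matrix whose columns are the normalised vectorisations of the operators `L i`. -/
noncomputable def vecFrame (L : Fin 4 → Matrix (Fin 2) (Fin 2) ℂ) :
    Matrix (Fin 2 × Fin 2) (Fin 4) ℂ :=
  Matrix.of fun x i => ((Real.sqrt 2 : ℝ) : ℂ)⁻¹ * (L i).vec x

theorem ofReal_sqrt_two_inv_mul_self :
    ((Real.sqrt 2 : ℝ) : ℂ)⁻¹ * ((Real.sqrt 2 : ℝ) : ℂ)⁻¹ = 1 / 2 := by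
  rw [← mul_inv, ← Complex.ofReal_mul, Real.mul_self_sqrt (by norm_num)]
  norm_num

theorem vecFrame_isometry {L : Fin 4 → Matrix (Fin 2) (Fin 2) ℂ}
    (hL : ∀ i j, ((L i)ᴴ * L j).trace = if i = j then 2 else 0) :
    (vecFrame L)ᴴ * vecFrame L = 1 := by
  ext i j
  have h := hL i j
  rw [← Matrix.star_vec_dotProduct_vec] at h
  have hs : ((vecFrame L)ᴴ * vecFrame L) i j =
      (((Real.sqrt 2 : ℝ) : ℂ)⁻¹ * ((Real.sqrt 2 : ℝ) : ℂ)⁻¹) *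
        (star (L i).vec ⬝ᵥ (L j).vec) := by
    rw [Matrix.mul_apply, dotProduct, Finset.mul_sum]
    refine Finset.sum_congr rfl fun x _ => ?_
    simp only [vecFrame, Matrix.conjTranspose_apply, Matrix.of_apply, star_mul', star_inv₀,
      Complex.star_def, Complex.conj_ofReal, Pi.star_apply]
    ring
  rw [hs, h, ofReal_sqrt_two_inv_mul_self, Matrix.one_apply]
  split_ifs <;> norm_num

/-- Four orthonormal columns in a four-dimensional space form a unitary matrix, so `H * Gᵀ` is a
product of unitaries. -/
theorem frame_mul_transpose_unitary {G H : Matrix (Fin 2 × Fin 2) (Fin 4) ℂ} (hG : Gᴴ * G = 1)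
    (hH : Hᴴ * H = 1) : (H * Gᵀ) * (H * Gᵀ)ᴴ = 1 := by
  have h1 : Gᵀ * Gᵀᴴ = 1 := by
    have := congrArg Matrix.transpose hG
    rw [Matrix.transpose_mul, Matrix.transpose_one] at this
    exact this
  rw [Matrix.conjTranspose_mul, Matrix.mul_assoc, ← Matrix.mul_assoc Gᵀ, h1, Matrix.one_mul]
  exact (Matrix.mul_eq_one_comm_of_card_eq (Fin 4) (Fin 2 × Fin 2) ℂ (by simp)).1 hH

theorem bipartiteChoi_unitaryChannel {m n : Type} [Fintype m] [Fintype n] [DecidableEq m]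
    [DecidableEq n] (U : Matrix (m × n) (m × n) ℂ) :
    bipartiteChoi (unitaryChannel U) =
      Matrix.vecMulVec (fun x => U (x.1.2, x.2.2) (x.1.1, x.2.1))
        (star fun x => U (x.1.2, x.2.2) (x.1.1, x.2.1)) := by
  ext x y
  simp only [bipartiteChoi, unitaryChannel, Matrix.of_apply, LinearMap.coe_mk, AddHom.coe_mk,
    Matrix.vecMulVec_apply, Matrix.mul_apply, Matrix.single_apply, Matrix.conjTranspose_apply,
    Pi.star_apply]
  rw [Finset.sum_eq_single (y.1.1, y.2.1), Finset.sum_eq_single (x.1.1, x.2.1)]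
  · simp
  · intro b _ hb
    simp [Ne.symm hb]
  · simp
  · intro b _ hb
    rw [Finset.sum_eq_zero, zero_mul]
    intro c _
    simp [Ne.symm hb]
  · simp

section

variable {U : Matrix (Fin 2 × Fin 2) (Fin 2 × Fin 2) ℂ} {u : Fin 4 → ℝ}
  {L R : Fin 4 → Matrix (Fin 2) (Fin 2) ℂ}

theorem HasUnitarySchmidt.apply_eq (h : HasUnitarySchmidt U u L R)
    (x y : Fin 2 × Fin 2) :
    U (x.2, y.2) (x.1, y.1) = 2 * ∑ i, (u i : ℂ) * (vecFrame L x i * vecFrame R y i) := by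
  rw [h.eq_sum, Matrix.sum_apply, Finset.mul_sum]
  refine Finset.sum_congr rfl fun i _ => ?_
  simp only [vecFrame, Matrix.of_apply, Matrix.vec, Matrix.smul_apply, Matrix.kroneckerMap_apply,
    smul_eq_mul]
  linear_combination (-2 * (u i : ℂ) * L i x.2 x.1 * R i y.2 y.1) * ofReal_sqrt_two_inv_mul_self

theorem HasUnitarySchmidt.trace_mul_conjTranspose (h : HasUnitarySchmidt U u L R) :
    (U * Uᴴ).trace = 4 := by
  rw [Matrix.trace_mul_comm]
  conv_lhs => rw [h.eq_sum]
  simp only [Matrix.conjTranspose_sum, Matrix.conjTranspose_smul, Matrix.conjTranspose_kronecker,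
    Finset.sum_mul, Finset.mul_sum, Matrix.smul_mul, Matrix.mul_smul, ← Matrix.mul_kronecker_mul,
    Matrix.trace_sum, Matrix.trace_smul, Matrix.trace_kronecker, h.left_orthogonal,
    h.right_orthogonal, smul_eq_mul]
  have hu : ∑ i, (u i : ℂ) ^ 2 = 1 := by exact_mod_cast h.sum_sq
  simp only [mul_ite, ite_mul, mul_zero, Finset.sum_ite_eq', Finset.mem_univ,
    if_true, Complex.star_def, Complex.conj_ofReal]
  have : ∀ i : Fin 4, (u i : ℂ) * ((u i : ℂ) * (2 * 2)) = 4 * (u i : ℂ) ^ 2 := fun i => by ring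
  simp [this, ← Finset.mul_sum, hu]

/-- The Choi matrix of the channel is the projector onto the vectorisation of `2 R diag(u) Lᵀ`, with
`R`, `L` the frames. The witness uses its unitary factor `R Lᵀ`, so the overlap is `2 ∑ u i` and the
value is `2 * 4 (∑ u i)² - 4`. -/
theorem HasUnitarySchmidt.dualWitness_eq (h : HasUnitarySchmidt U u L R) :
    dualWitness (vecFrame R * (vecFrame L)ᵀ) (unitaryChannel U) =
      ((4 * (2 * (∑ i, u i) ^ 2 - 1) : ℝ) : ℂ) := by
  set W := vecFrame R * (vecFrame L)ᵀ with hWdef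
  set v : (Fin 2 × Fin 2) × (Fin 2 × Fin 2) → ℂ :=
    fun x => U (x.1.2, x.2.2) (x.1.1, x.2.1) with hv
  have hvec : v = ((2 : ℂ) • (vecFrame R * Matrix.diagonal (fun i => (u i : ℂ)) *
      (vecFrame L)ᵀ)).vec := by
    ext x
    simp only [hv, h.apply_eq, Matrix.vec, Matrix.smul_apply, smul_eq_mul]
    rw [Matrix.mul_apply]
    congr 1
    refine Finset.sum_congr rfl fun i _ => ?_
    rw [Matrix.mul_diagonal, Matrix.transpose_apply]
    ring
  have h1 : (vecFrame L)ᵀ * (vecFrame L)ᵀᴴ = 1 := by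
    have := congrArg Matrix.transpose (vecFrame_isometry h.left_orthogonal)
    rw [Matrix.transpose_mul, Matrix.transpose_one] at this
    exact this
  have hWv : star W.vec ⬝ᵥ v = 2 * ∑ i, (u i : ℂ) := by
    rw [hvec, Matrix.star_vec_dotProduct_vec, hWdef, Matrix.conjTranspose_mul, Matrix.mul_smul,
      Matrix.trace_smul, Matrix.mul_assoc, ← Matrix.mul_assoc (vecFrame R)ᴴ,
      ← Matrix.mul_assoc (vecFrame R)ᴴ, vecFrame_isometry h.right_orthogonal, Matrix.one_mul,
      Matrix.trace_mul_comm, Matrix.mul_assoc, h1, Matrix.mul_one, Matrix.trace_diagonal,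
      smul_eq_mul]
  have hvW : star v ⬝ᵥ W.vec = 2 * ∑ i, (u i : ℂ) := by
    have := congrArg star hWv
    rw [← Matrix.star_dotProduct_star, star_star] at this
    rw [this]
    simp
  change 2 * (star W.vec ⬝ᵥ (bipartiteChoi (unitaryChannel U) *ᵥ W.vec)) -
    (U * 1 * Uᴴ).trace = _
  rw [bipartiteChoi_unitaryChannel, Matrix.mul_one, h.trace_mul_conjTranspose, Matrix.vecMulVec_mulVec]
  change 2 * (star W.vec ⬝ᵥ (MulOpposite.op (star v ⬝ᵥ W.vec) • v)) - 4 = _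
  rw [hvW, dotProduct_smul, hWv]
  simp only [MulOpposite.smul_eq_mul_unop, MulOpposite.unop_op]
  push_cast
  ring

theorem HasUnitarySchmidt.le_of_mem_qpdCosts (h : HasUnitarySchmidt U u L R)
    {S : Set (Superop (Fin 2 × Fin 2) (Fin 2 × Fin 2))} (hS : ∀ F ∈ S, IsSignedSeparable F)
    {κ : ℝ} (hκ : κ ∈ qpdCosts S (unitaryChannel U)) : 2 * (∑ i, u i) ^ 2 - 1 ≤ κ := by
  have hW := frame_mul_transpose_unitary (vecFrame_isometry h.left_orthogonal)
    (vecFrame_isometry h.right_orthogonal)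
  have hle := norm_dualWitness_le_of_mem_qpdCosts hW hS hκ
  rw [h.dualWitness_eq, Complex.norm_real] at hle
  have := (le_abs_self _).trans hle
  push_cast at this
  linarith

end

/-! ### Optimal decompositions into local operations -/

/-- The superoperator `X ↦ K X Kᴴ`. -/
def conjMap {m n : Type} [Fintype m] (K : Matrix n m ℂ) : Superop m n where
  toFun X := K * X * Kᴴ
  map_add' X Y := by rw [Matrix.mul_add, Matrix.add_mul]
  map_smul' c X := by simp

theorem conjMap_apply {m n : Type} [Fintype m] (K : Matrix n m ℂ) (X : Matrix m m ℂ) :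
    conjMap K X = K * X * Kᴴ := rfl

theorem isCP_conjMap {m n : Type} [Fintype m] [Finite n] (K : Matrix n m ℂ) :
    IsCP (conjMap K) := by
  intro k X hX
  have h : tensorMap (LinearMap.id : Superop (Fin k) (Fin k)) (conjMap K) =
      conjMap ((1 : Matrix (Fin k) (Fin k) ℂ) ⊗ₖ K) := by
    refine superop_ext_kronecker fun A B => ?_
    rw [tensorMap_kronecker, conjMap_apply, conjMap_apply, Matrix.conjTranspose_kronecker,
      ← Matrix.mul_kronecker_mul, ← Matrix.mul_kronecker_mul]
    simp
  rw [h]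
  exact hX.mul_mul_conjTranspose_same _

theorem IsCP.add {m n : Type} {Φ Ψ : Superop m n} (hΦ : IsCP Φ) (hΨ : IsCP Ψ) :
    IsCP (Φ + Ψ) := fun k X hX => (hΦ k X hX).add (hΨ k X hX)

theorem IsCP.smul {m n : Type} {Φ : Superop m n} (hΦ : IsCP Φ) {c : ℂ} (hc : 0 ≤ c) :
    IsCP (c • Φ) := fun k X hX => (hΦ k X hX).smul hc

/-- The superoperator `X ↦ (P X Qᴴ + Q X Pᴴ) / 2`. -/
noncomputable def crossMap (P Q : Matrix (Fin 2) (Fin 2) ℂ) : Superop (Fin 2) (Fin 2) where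
  toFun X := (1 / 2 : ℂ) • (P * X * Qᴴ + Q * X * Pᴴ)
  map_add' X Y := by
    rw [← smul_add]
    congr 1
    simp only [mul_add, add_mul]
    abel
  map_smul' c X := by
    simp only [Matrix.mul_smul, Matrix.smul_mul, RingHom.id_apply, ← smul_add]
    rw [smul_comm]

/-- Polarisation: the map is a quarter of the difference of conjugations by `P + Q` and `P - Q`. In
their sum the cross terms cancel, leaving the average of conjugations by `P` and `Q`, which
preserves the trace. -/
theorem isD_crossMap {P Q : Matrix (Fin 2) (Fin 2) ℂ} (hP : Pᴴ * P = 1) (hQ : Qᴴ * Q = 1) :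
    IsD (crossMap P Q) := by
  have h4 : (0 : ℂ) ≤ 1 / 4 := by
    rw [show (1 / 4 : ℂ) = ((1 / 4 : ℝ) : ℂ) by norm_num]
    exact Complex.zero_le_real.2 (by norm_num)
  have hp : IsCP ((1 / 4 : ℂ) • conjMap (P + Q)) := (isCP_conjMap _).smul h4
  have hm : IsCP ((1 / 4 : ℂ) • conjMap (P - Q)) := (isCP_conjMap _).smul h4
  have htr : ∀ X : Matrix (Fin 2) (Fin 2) ℂ, ((((1 / 4 : ℂ) • conjMap (P + Q)) +
      (1 / 4 : ℂ) • conjMap (P - Q)) X).trace = X.trace := by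
    intro X
    have hP' : (P * X * Pᴴ).trace = X.trace := by
      rw [Matrix.trace_mul_cycle, hP, Matrix.one_mul]
    have hQ' : (Q * X * Qᴴ).trace = X.trace := by
      rw [Matrix.trace_mul_cycle, hQ, Matrix.one_mul]
    simp only [LinearMap.add_apply, LinearMap.smul_apply, conjMap_apply, Matrix.trace_add,
      Matrix.trace_smul, smul_eq_mul, Matrix.conjTranspose_add, Matrix.conjTranspose_sub, add_mul,
      mul_add, sub_mul, mul_sub, Matrix.trace_sub, hP', hQ']
    ring
  have hsum : ∀ X : Matrix (Fin 2) (Fin 2) ℂ,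
      (((1 / 4 : ℂ) • conjMap (P + Q)) X).trace.re + (((1 / 4 : ℂ) • conjMap (P - Q)) X).trace.re
        = X.trace.re := by
    intro X
    rw [← htr X, LinearMap.add_apply, Matrix.trace_add, Complex.add_re]
  refine ⟨(1 / 4 : ℂ) • conjMap (P + Q), (1 / 4 : ℂ) • conjMap (P - Q), ⟨hp, fun X hX => ?_⟩,
    ⟨hm, fun X hX => ?_⟩, ?_, hp.add hm, fun X _ => by rw [htr]⟩
  · linarith [hsum X, hm.trace_nonneg hX]
  · linarith [hsum X, hp.trace_nonneg hX]
  · ext1 X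
    change (1 / 2 : ℂ) • (P * X * Qᴴ + Q * X * Pᴴ) =
      (1 / 4 : ℂ) • ((P + Q) * X * (P + Q)ᴴ) - (1 / 4 : ℂ) • ((P - Q) * X * (P - Q)ᴴ)
    simp only [Matrix.conjTranspose_add, Matrix.conjTranspose_sub, add_mul, mul_add, sub_mul,
      mul_sub]
    module

theorem mem_qpdCosts_of_fintype {m n ι : Type} [Fintype ι] [Nonempty ι] {S : Set (Superop m n)}
    {E : Superop m n} (a : ι → ℝ) (F : ι → Superop m n) (hF : ∀ i, F i ∈ S)
    (hE : E = ∑ i, (a i : ℂ) • F i) : ∑ i, |a i| ∈ qpdCosts S E := by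
  let e := Fintype.equivFin ι
  refine ⟨Fintype.card ι, Fintype.card_pos, a ∘ e.symm, F ∘ e.symm, fun i => hF _, ?_, ?_⟩
  · rw [hE]
    exact (Equiv.sum_comp e.symm fun i => (a i : ℂ) • F i).symm
  · exact (Equiv.sum_comp e.symm fun i => |a i|).symm

theorem crossMap_apply (P Q X : Matrix (Fin 2) (Fin 2) ℂ) (s t : Fin 2) :
    crossMap P Q X s t = 1 / 2 * ((P * X * Qᴴ) s t + (Q * X * Pᴴ) s t) := rfl

/-- The factor `-i` keeps `P` unitary, hence the map in `D`, and turns the symmetric combination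
into the antisymmetric one. -/
theorem crossMap_neg_I_smul_apply (P Q X : Matrix (Fin 2) (Fin 2) ℂ) (s t : Fin 2) :
    crossMap ((-Complex.I) • P) Q X s t =
      -Complex.I / 2 * ((P * X * Qᴴ) s t - (Q * X * Pᴴ) s t) := by
  rw [crossMap_apply]
  simp only [Matrix.conjTranspose_smul, Matrix.smul_mul, Matrix.mul_smul, Matrix.smul_apply,
    smul_eq_mul, star_neg, Complex.star_def, Complex.conj_I]
  ring

/-- With `a = L i A (L j)ᴴ`, `b = R i B (R j)ᴴ` and `a'`, `b'` their versions with `i`, `j`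
exchanged, `(ab + a'b')/2 = (a+a')(b+b')/4 + (a-a')(b-b')/4`. The minus sign in the statement comes
from `(-i/2)² = -1/4`. -/
theorem HasUnitarySchmidt.unitaryChannel_eq {U : Matrix (Fin 2 × Fin 2) (Fin 2 × Fin 2) ℂ}
    {u : Fin 4 → ℝ} {L R : Fin 4 → Matrix (Fin 2) (Fin 2) ℂ} (h : HasUnitarySchmidt U u L R) :
    unitaryChannel U = ∑ i, ∑ j, ((u i * u j : ℝ) : ℂ) •
      (tensorMap (crossMap (L i) (L j)) (crossMap (R i) (R j)) -
        tensorMap (crossMap ((-Complex.I) • L i) (L j)) (crossMap ((-Complex.I) • R i) (R j))) := by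
  refine superop_ext_kronecker fun A B => ?_
  ext s t
  have hl : unitaryChannel U (A ⊗ₖ B) s t = ∑ i, ∑ j, (u i : ℂ) * (u j : ℂ) *
      ((L i * A * (L j)ᴴ) s.1 t.1 * (R i * B * (R j)ᴴ) s.2 t.2) := by
    change (U * (A ⊗ₖ B) * Uᴴ) s t = _
    rw [h.eq_sum]
    simp only [Matrix.conjTranspose_sum, Matrix.conjTranspose_smul,
      Matrix.conjTranspose_kronecker, Finset.sum_mul, Finset.mul_sum, Matrix.smul_mul,
      Matrix.mul_smul, ← Matrix.mul_kronecker_mul, Matrix.sum_apply, Matrix.smul_apply,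
      Matrix.kroneckerMap_apply, smul_eq_mul, Complex.star_def, Complex.conj_ofReal]
    rw [Finset.sum_comm]
    exact Finset.sum_congr rfl fun i _ => Finset.sum_congr rfl fun j _ => by ring
  have hsymm : unitaryChannel U (A ⊗ₖ B) s t = ∑ i, ∑ j, (u i : ℂ) * (u j : ℂ) *
      ((L j * A * (L i)ᴴ) s.1 t.1 * (R j * B * (R i)ᴴ) s.2 t.2) := by
    rw [hl, Finset.sum_comm]
    exact Finset.sum_congr rfl fun i _ => Finset.sum_congr rfl fun j _ => by ring
  have hhalf : unitaryChannel U (A ⊗ₖ B) s t =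
      1 / 2 * (unitaryChannel U (A ⊗ₖ B) s t + unitaryChannel U (A ⊗ₖ B) s t) := by ring
  rw [hhalf]
  nth_rewrite 1 [hl]
  rw [hsymm, ← Finset.sum_add_distrib, Finset.mul_sum]
  simp only [LinearMap.sum_apply, LinearMap.smul_apply, LinearMap.sub_apply, tensorMap_kronecker,
    Matrix.sum_apply, Matrix.smul_apply, Matrix.sub_apply, Matrix.kroneckerMap_apply,
    crossMap_neg_I_smul_apply, smul_eq_mul, Complex.ofReal_mul]
  simp only [crossMap_apply]
  refine Finset.sum_congr rfl fun i _ => ?_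
  rw [← Finset.sum_add_distrib, Finset.mul_sum]
  refine Finset.sum_congr rfl fun j _ => ?_
  linear_combination ((u i : ℂ) * u j / 4 * ((L i * A * (L j)ᴴ) s.1 t.1 - (L j * A * (L i)ᴴ) s.1 t.1)
    * ((R i * B * (R j)ᴴ) s.2 t.2 - (R j * B * (R i)ᴴ) s.2 t.2)) * Complex.I_sq

theorem neg_I_smul_unitary {P : Matrix (Fin 2) (Fin 2) ℂ} (hP : Pᴴ * P = 1) :
    ((-Complex.I) • P)ᴴ * ((-Complex.I) • P) = 1 := by
  simp [Matrix.conjTranspose_smul, smul_smul, hP]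

theorem HasUnitarySchmidt.mem_qpdCosts_LO {U : Matrix (Fin 2 × Fin 2) (Fin 2 × Fin 2) ℂ}
    {u : Fin 4 → ℝ} {L R : Fin 4 → Matrix (Fin 2) (Fin 2) ℂ} (h : HasUnitarySchmidt U u L R) :
    2 * (∑ i, u i) ^ 2 - 1 ∈ qpdCosts (LO 2 2 2 2) (unitaryChannel U) := by
  -- The antisymmetric maps vanish for `i = j`, so their coefficients are set to 0 there. This saves
  -- `∑ u i ^ 2 = 1` in the cost.
  let a : (Fin 4 × Fin 4) ⊕ (Fin 4 × Fin 4) → ℝ :=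
    Sum.elim (fun p => u p.1 * u p.2) fun p => if p.1 = p.2 then 0 else -(u p.1 * u p.2)
  let F : (Fin 4 × Fin 4) ⊕ (Fin 4 × Fin 4) → Superop (Fin 2 × Fin 2) (Fin 2 × Fin 2) :=
    Sum.elim (fun p => tensorMap (crossMap (L p.1) (L p.2)) (crossMap (R p.1) (R p.2)))
      fun p => tensorMap (crossMap ((-Complex.I) • L p.1) (L p.2))
        (crossMap ((-Complex.I) • R p.1) (R p.2))
  have hF : ∀ x, F x ∈ LO 2 2 2 2 := by
    rintro (p | p)
    · exact ⟨_, _, isD_crossMap (h.left_unitary _) (h.left_unitary _),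
        isD_crossMap (h.right_unitary _) (h.right_unitary _), rfl⟩
    · exact ⟨_, _, isD_crossMap (neg_I_smul_unitary (h.left_unitary _)) (h.left_unitary _),
        isD_crossMap (neg_I_smul_unitary (h.right_unitary _)) (h.right_unitary _), rfl⟩
  have hE : unitaryChannel U = ∑ x, (a x : ℂ) • F x := by
    rw [h.unitaryChannel_eq, Fintype.sum_sum_type, ← Finset.sum_add_distrib,
      ← Fintype.sum_prod_type']
    refine Finset.sum_congr rfl fun p _ => ?_
    obtain ⟨i, j⟩ := p
    by_cases hij : i = j
    · subst hij
      have h0 : tensorMap (crossMap ((-Complex.I) • L i) (L i)) (crossMap ((-Complex.I) • R i) (R i))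
          = 0 := by
        refine superop_ext_kronecker fun A B => ?_
        ext s t
        rw [tensorMap_kronecker, Matrix.kroneckerMap_apply, crossMap_neg_I_smul_apply, sub_self,
          mul_zero, zero_mul]
        rfl
      simp only [a, F, Sum.elim_inl, Sum.elim_inr, if_true, h0, sub_zero, Complex.ofReal_zero,
        zero_smul, add_zero]
    · simp only [a, F, Sum.elim_inl, Sum.elim_inr, if_neg hij]
      rw [smul_sub, sub_eq_add_neg, Complex.ofReal_neg]
      exact congrArg _ (neg_smul _ _).symm
  have hcost : ∑ x, |a x| = 2 * (∑ i, u i) ^ 2 - 1 := by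
    have h1 : ∑ p : Fin 4 × Fin 4, u p.1 * u p.2 = (∑ i, u i) ^ 2 := by
      rw [sq, Finset.sum_mul_sum, Fintype.sum_prod_type]
    have h2 : ∑ p : Fin 4 × Fin 4, (if p.1 = p.2 then u p.1 * u p.2 else 0) = 1 := by
      rw [Fintype.sum_prod_type, ← h.sum_sq]
      simp [sq]
    rw [Fintype.sum_sum_type]
    have h3 : ∀ p : Fin 4 × Fin 4, |a (Sum.inl p)| = u p.1 * u p.2 := fun p =>
      abs_of_nonneg (mul_nonneg (h.nonneg _) (h.nonneg _))
    have h4 : ∀ p : Fin 4 × Fin 4, |a (Sum.inr p)| =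
        u p.1 * u p.2 - if p.1 = p.2 then u p.1 * u p.2 else 0 := by
      intro p
      simp only [a, Sum.elim_inr]
      split_ifs
      · simp
      · rw [abs_neg, abs_of_nonneg (mul_nonneg (h.nonneg _) (h.nonneg _)), sub_zero]
    simp only [h3, h4, Finset.sum_sub_distrib, h1, h2]
    ring
  rw [← hcost]
  exact mem_qpdCosts_of_fintype a F hF hE

/-- Only the inclusions between LO and signed separable maps matter, so one statement serves all
three classes. -/
theorem HasUnitarySchmidt.isLeast_qpdCosts {U : Matrix (Fin 2 × Fin 2) (Fin 2 × Fin 2) ℂ}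
    {u : Fin 4 → ℝ} {L R : Fin 4 → Matrix (Fin 2) (Fin 2) ℂ} (h : HasUnitarySchmidt U u L R)
    {S : Set (Superop (Fin 2 × Fin 2) (Fin 2 × Fin 2))} (hLO : LO 2 2 2 2 ⊆ S)
    (hS : ∀ F ∈ S, IsSignedSeparable F) :
    IsLeast (qpdCosts S (unitaryChannel U)) (2 * (∑ i, u i) ^ 2 - 1) := by
  refine ⟨?_, fun κ hκ => h.le_of_mem_qpdCosts hS hκ⟩
  obtain ⟨N, hN, a, F, hF, hE⟩ := h.mem_qpdCosts_LO
  exact ⟨N, hN, a, F, fun i => hLO (hF i), hE⟩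

/-! ### Schmidt coefficients -/

/-- The swap is needed because `Matrix.vec` indexes by (column, row), while the Choi state lists the
output `A` before the reference `A'`. -/
theorem HasUnitarySchmidt.isSchmidtDecomposition
    {U : Matrix (Fin 2 × Fin 2) (Fin 2 × Fin 2) ℂ}
    {u : Fin 4 → ℝ} {L R : Fin 4 → Matrix (Fin 2) (Fin 2) ℂ} (h : HasUnitarySchmidt U u L R) :
    IsSchmidtDecomposition (choiState U) u
      (fun i => WithLp.toLp 2 fun x => vecFrame L x.swap i)
      (fun i => WithLp.toLp 2 fun x => vecFrame R x.swap i) := by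
  have horth : ∀ K : Fin 4 → Matrix (Fin 2) (Fin 2) ℂ,
      (∀ i j, ((K i)ᴴ * K j).trace = if i = j then 2 else 0) →
      Orthonormal ℂ fun i => (WithLp.toLp 2 fun x => vecFrame K x.swap i :
        EuclideanSpace ℂ (Fin 2 × Fin 2)) := by
    intro K hK
    rw [orthonormal_iff_ite]
    intro i j
    have := congrFun (congrFun (vecFrame_isometry hK) i) j
    rw [Matrix.mul_apply, Matrix.one_apply] at this
    rw [← this, ← (Equiv.prodComm (Fin 2) (Fin 2)).sum_comp]
    simp [PiLp.inner_apply, mul_comm]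
  refine ⟨h.nonneg, horth L h.left_orthogonal, horth R h.right_orthogonal, ?_⟩
  intro x y
  have h2 := h.apply_eq x.swap y.swap
  have h3 : choiState U (x, y) = 1 / 2 * U (x.1, y.1) (x.2, y.2) := by
    have hd : (((1 / Real.sqrt (2 : ℕ) : ℝ)) : ℂ) * (((1 / Real.sqrt (2 : ℕ) : ℝ)) : ℂ) = 1 / 2 := by
      simpa [one_div] using ofReal_sqrt_two_inv_mul_self
    simp only [choiState, maxEntangled]
    rw [Finset.sum_eq_single (x.2, y.2)]
    · rw [if_pos rfl, if_pos rfl, hd, mul_comm]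
    · rintro ⟨p, q⟩ _ hpq
      by_cases hp : p = x.2
      · have hq : q ≠ y.2 := fun hq => hpq (by rw [hp, hq])
        simp [hq]
      · simp [hp]
    · simp
  rw [h3]
  simp only [Prod.fst_swap, Prod.snd_swap] at h2
  rw [h2]
  ring

/-- Pair `ψ` with `∑ e i ⊗ f i`. The first decomposition gives `∑ α i`; in the second, each `β j` is
multiplied by a number of modulus at most 1, by Bessel's inequality for both families. Applied both
ways it gives equality without matching the coefficients, even if some vanish. -/
theorem IsSchmidtDecomposition.sum_le {m n : Type} [Fintype m] [Fintype n] {k l : ℕ}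
    {ψ : m × n → ℂ} {α : Fin k → ℝ} {e : Fin k → EuclideanSpace ℂ m}
    {f : Fin k → EuclideanSpace ℂ n} {β : Fin l → ℝ} {g : Fin l → EuclideanSpace ℂ m}
    {h : Fin l → EuclideanSpace ℂ n} (hα : IsSchmidtDecomposition ψ α e f)
    (hβ : IsSchmidtDecomposition ψ β g h) : ∑ i, α i ≤ ∑ j, β j := by
  have key : ∀ {r : ℕ} {γ : Fin r → ℝ} {p : Fin r → EuclideanSpace ℂ m}
      {q : Fin r → EuclideanSpace ℂ n}, IsSchmidtDecomposition ψ γ p q →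
      ∑ i, ∑ x, ∑ y, star (e i x) * star (f i y) * ψ (x, y) =
        ∑ j, (γ j : ℂ) * ∑ i, inner ℂ (e i) (p j) * inner ℂ (f i) (q j) := by
    intro r γ p q hγ
    simp only [hγ.2.2.2, PiLp.inner_apply, Finset.mul_sum, Finset.sum_mul]
    calc _ = ∑ i, ∑ x, ∑ j, ∑ y, star (e i x) * star (f i y) * ((γ j : ℂ) * (p j x * q j y)) :=
          Finset.sum_congr rfl fun i _ => Finset.sum_congr rfl fun x _ => Finset.sum_comm
      _ = ∑ i, ∑ j, ∑ x, ∑ y, star (e i x) * star (f i y) * ((γ j : ℂ) * (p j x * q j y)) :=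
          Finset.sum_congr rfl fun i _ => Finset.sum_comm
      _ = ∑ j, ∑ i, ∑ x, ∑ y, star (e i x) * star (f i y) * ((γ j : ℂ) * (p j x * q j y)) :=
          Finset.sum_comm
      _ = _ := by
          refine Finset.sum_congr rfl fun j _ => Finset.sum_congr rfl fun i _ => ?_
          rw [Finset.sum_comm]
          exact Finset.sum_congr rfl fun x _ => Finset.sum_congr rfl fun y _ => by
            simp only [RCLike.inner_apply, Complex.star_def]; ring
  have h1 : ∑ i, ∑ x, ∑ y, star (e i x) * star (f i y) * ψ (x, y) = ((∑ i, α i : ℝ) : ℂ) := by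
    rw [key hα]
    push_cast
    refine Finset.sum_congr rfl fun j _ => ?_
    simp [orthonormal_iff_ite.1 hα.2.1, orthonormal_iff_ite.1 hα.2.2.1]
  have h2 := (key hβ).symm.trans h1
  have h3 : ∀ j, ‖∑ i, inner ℂ (e i) (g j) * inner ℂ (f i) (h j)‖ ≤ 1 := by
    intro j
    have hb1 := hα.2.1.sum_inner_products_le (s := Finset.univ) (g j)
    have hb2 := hα.2.2.1.sum_inner_products_le (s := Finset.univ) (h j)
    rw [hβ.2.1.1 j, one_pow] at hb1
    rw [hβ.2.2.1.1 j, one_pow] at hb2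
    calc _ ≤ ∑ i, ‖inner ℂ (e i) (g j)‖ * ‖inner ℂ (f i) (h j)‖ := by
          refine (norm_sum_le _ _).trans_eq (Finset.sum_congr rfl fun i _ => norm_mul _ _)
      _ ≤ ∑ i, (‖inner ℂ (e i) (g j)‖ ^ 2 + ‖inner ℂ (f i) (h j)‖ ^ 2) / 2 :=
          Finset.sum_le_sum fun i _ => by
            nlinarith [sq_nonneg (‖inner ℂ (e i) (g j)‖ - ‖inner ℂ (f i) (h j)‖)]
      _ ≤ 1 := by
          rw [← Finset.sum_div, Finset.sum_add_distrib]
          linarith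
  have h4 : ∑ i, α i = ‖((∑ i, α i : ℝ) : ℂ)‖ := by
    rw [Complex.norm_real, Real.norm_of_nonneg (Finset.sum_nonneg fun i _ => hα.1 i)]
  rw [h4, ← h2]
  refine (norm_sum_le _ _).trans (Finset.sum_le_sum fun j _ => ?_)
  rw [norm_mul, Complex.norm_real, Real.norm_of_nonneg (hβ.1 j)]
  exact mul_le_of_le_one_right (hβ.1 j) (h3 j)

/-! ### The canonical form of two-qubit unitaries -/

/-- Even powers of `A` are 1 and odd powers are `A`, so the two halves of the series are those of
cosine and sine. -/
theorem exp_smul_of_mul_self_eq_one {n : Type} [Fintype n] [DecidableEq n] {A : Matrix n n ℂ}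
    (hA : A * A = 1) (t : ℝ) : NormedSpace.exp ((Complex.I * (t : ℂ)) • A) =
      (Real.cos t : ℂ) • (1 : Matrix n n ℂ) + (Complex.I * (Real.sin t : ℂ)) • A := by
  have hpow : ∀ k, A ^ (2 * k) = 1 := fun k => by rw [pow_mul, sq, hA, one_pow]
  rw [NormedSpace.exp_eq_tsum ℂ]
  refine HasSum.tsum_eq (HasSum.even_add_odd ?_ ?_)
  · have h := (Complex.hasSum_cos' (t : ℂ)).smul_const (1 : Matrix n n ℂ)
    rw [Complex.ofReal_cos]
    refine (congrArg (HasSum · _) (funext fun k => ?_)).mpr h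
    rw [smul_pow, hpow, smul_smul, div_eq_inv_mul, mul_comm (t : ℂ)]
  · have h := ((Complex.hasSum_sin' (t : ℂ)).mul_left Complex.I).smul_const A
    rw [Complex.ofReal_sin]
    refine (congrArg (HasSum · _) (funext fun k => ?_)).mpr h
    rw [smul_pow, pow_succ A, hpow, one_mul, smul_smul, mul_comm (t : ℂ)]
    congr 1
    field_simp

/-- The Pauli basis `1, X, Y, Z`. -/
def pauli : Fin 4 → Matrix (Fin 2) (Fin 2) ℂ := ![1, pauliX, pauliY, pauliZ]

theorem pauliX_mul_self : pauliX * pauliX = 1 := by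
  ext i j; fin_cases i <;> fin_cases j <;> simp [pauliX]

theorem pauliY_mul_self : pauliY * pauliY = 1 := by
  ext i j; fin_cases i <;> fin_cases j <;> simp [pauliY]

theorem pauliZ_mul_self : pauliZ * pauliZ = 1 := by
  ext i j; fin_cases i <;> fin_cases j <;> simp [pauliZ]

theorem pauliX_mul_pauliY : pauliX * pauliY = Complex.I • pauliZ := by
  ext i j; fin_cases i <;> fin_cases j <;> simp [pauliX, pauliY, pauliZ]

theorem pauliY_mul_pauliX : pauliY * pauliX = (-Complex.I) • pauliZ := by
  ext i j; fin_cases i <;> fin_cases j <;> simp [pauliX, pauliY, pauliZ]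

theorem pauliY_mul_pauliZ : pauliY * pauliZ = Complex.I • pauliX := by
  ext i j; fin_cases i <;> fin_cases j <;> simp [pauliX, pauliY, pauliZ]

theorem pauliZ_mul_pauliY : pauliZ * pauliY = (-Complex.I) • pauliX := by
  ext i j; fin_cases i <;> fin_cases j <;> simp [pauliX, pauliY, pauliZ]

theorem pauliZ_mul_pauliX : pauliZ * pauliX = Complex.I • pauliY := by
  ext i j; fin_cases i <;> fin_cases j <;> simp [pauliX, pauliY, pauliZ]

theorem pauliX_mul_pauliZ : pauliX * pauliZ = (-Complex.I) • pauliY := by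
  ext i j; fin_cases i <;> fin_cases j <;> simp [pauliX, pauliY, pauliZ]

theorem pauli_conjTranspose_mul_self (i : Fin 4) : (pauli i)ᴴ * pauli i = 1 := by
  fin_cases i <;> ext i j <;> fin_cases i <;> fin_cases j <;>
    simp [pauli, pauliX, pauliY, pauliZ, Matrix.mul_apply]

theorem pauli_orthogonal (i j : Fin 4) :
    ((pauli i)ᴴ * pauli j).trace = if i = j then 2 else 0 := by
  fin_cases i <;> fin_cases j <;>
    simp [pauli, pauliX, pauliY, pauliZ, Matrix.mul_apply, Matrix.trace, one_add_one_eq_two]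

theorem smul_kronecker_smul (c d : ℂ) (A B : Matrix (Fin 2) (Fin 2) ℂ) :
    (c • A) ⊗ₖ (d • B) = (c * d) • (A ⊗ₖ B) := by
  rw [Matrix.smul_kronecker, Matrix.kronecker_smul, smul_smul]

/-- The coefficients of `exp(iθ_X X⊗X + iθ_Y Y⊗Y + iθ_Z Z⊗Z)` in the basis `σ_i ⊗ σ_i`. -/
noncomputable def kakCoeff (θX θY θZ : ℝ) : Fin 4 → ℂ :=
  ![⟨Real.cos θX * Real.cos θY * Real.cos θZ, Real.sin θX * Real.sin θY * Real.sin θZ⟩,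
    ⟨Real.cos θX * Real.sin θY * Real.sin θZ, Real.sin θX * Real.cos θY * Real.cos θZ⟩,
    ⟨Real.sin θX * Real.cos θY * Real.sin θZ, Real.cos θX * Real.sin θY * Real.cos θZ⟩,
    ⟨Real.sin θX * Real.sin θY * Real.cos θZ, Real.cos θX * Real.cos θY * Real.sin θZ⟩]

/-- The three `σ ⊗ σ` commute, square to 1, and the product of any two is minus the third. The
exponential therefore splits into three factors of the form `cos + i sin`, which are multiplied out.
-/
theorem exp_kak (θX θY θZ : ℝ) :
    NormedSpace.exp ((Complex.I * (θX : ℂ)) • (pauliX ⊗ₖ pauliX) +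
        (Complex.I * (θY : ℂ)) • (pauliY ⊗ₖ pauliY) +
        (Complex.I * (θZ : ℂ)) • (pauliZ ⊗ₖ pauliZ)) =
      ∑ i, kakCoeff θX θY θZ i • (pauli i ⊗ₖ pauli i) := by
  have hXY : (pauliX ⊗ₖ pauliX) * (pauliY ⊗ₖ pauliY) = -(pauliZ ⊗ₖ pauliZ) := by
    rw [← Matrix.mul_kronecker_mul, pauliX_mul_pauliY, smul_kronecker_smul]
    simp
  have hYX : (pauliY ⊗ₖ pauliY) * (pauliX ⊗ₖ pauliX) = -(pauliZ ⊗ₖ pauliZ) := by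
    rw [← Matrix.mul_kronecker_mul, pauliY_mul_pauliX, smul_kronecker_smul]
    simp
  have hYZ : (pauliY ⊗ₖ pauliY) * (pauliZ ⊗ₖ pauliZ) = -(pauliX ⊗ₖ pauliX) := by
    rw [← Matrix.mul_kronecker_mul, pauliY_mul_pauliZ, smul_kronecker_smul]
    simp
  have hZY : (pauliZ ⊗ₖ pauliZ) * (pauliY ⊗ₖ pauliY) = -(pauliX ⊗ₖ pauliX) := by
    rw [← Matrix.mul_kronecker_mul, pauliZ_mul_pauliY, smul_kronecker_smul]
    simp
  have hZX : (pauliZ ⊗ₖ pauliZ) * (pauliX ⊗ₖ pauliX) = -(pauliY ⊗ₖ pauliY) := by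
    rw [← Matrix.mul_kronecker_mul, pauliZ_mul_pauliX, smul_kronecker_smul]
    simp
  have hXZ : (pauliX ⊗ₖ pauliX) * (pauliZ ⊗ₖ pauliZ) = -(pauliY ⊗ₖ pauliY) := by
    rw [← Matrix.mul_kronecker_mul, pauliX_mul_pauliZ, smul_kronecker_smul]
    simp
  have hXX : (pauliX ⊗ₖ pauliX) * (pauliX ⊗ₖ pauliX) = 1 := by
    rw [← Matrix.mul_kronecker_mul, pauliX_mul_self, Matrix.one_kronecker_one]
  have hYY : (pauliY ⊗ₖ pauliY) * (pauliY ⊗ₖ pauliY) = 1 := by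
    rw [← Matrix.mul_kronecker_mul, pauliY_mul_self, Matrix.one_kronecker_one]
  have hZZ : (pauliZ ⊗ₖ pauliZ) * (pauliZ ⊗ₖ pauliZ) = 1 := by
    rw [← Matrix.mul_kronecker_mul, pauliZ_mul_self, Matrix.one_kronecker_one]
  have h1 : (pauli 0 ⊗ₖ pauli 0) = 1 := Matrix.one_kronecker_one
  have cXY : Commute (pauliX ⊗ₖ pauliX) (pauliY ⊗ₖ pauliY) := hXY.trans hYX.symm
  have cXZ : Commute (pauliX ⊗ₖ pauliX) (pauliZ ⊗ₖ pauliZ) := hXZ.trans hZX.symm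
  have cYZ : Commute (pauliY ⊗ₖ pauliY) (pauliZ ⊗ₖ pauliZ) := hYZ.trans hZY.symm
  rw [Matrix.exp_add_of_commute _ _ (Commute.add_left ((cXZ.smul_left _).smul_right _)
      ((cYZ.smul_left _).smul_right _)),
    Matrix.exp_add_of_commute _ _ ((cXY.smul_left _).smul_right _),
    exp_smul_of_mul_self_eq_one hXX, exp_smul_of_mul_self_eq_one hYY,
    exp_smul_of_mul_self_eq_one hZZ, Fin.sum_univ_four, h1]
  change _ = _ + kakCoeff θX θY θZ 1 • (pauliX ⊗ₖ pauliX) +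
    kakCoeff θX θY θZ 2 • (pauliY ⊗ₖ pauliY) + kakCoeff θX θY θZ 3 • (pauliZ ⊗ₖ pauliZ)
  -- Powers of `Complex.I` stay unreduced so that the final `module` can treat it as an atom.
  have e0 : kakCoeff θX θY θZ 0 = (Real.cos θX : ℂ) * Real.cos θY * Real.cos θZ -
      Complex.I * Complex.I * Complex.I * Real.sin θX * Real.sin θY * Real.sin θZ := by
    apply Complex.ext <;> simp [kakCoeff, -Complex.ofReal_cos, -Complex.ofReal_sin]
  have e1 : kakCoeff θX θY θZ 1 = Complex.I * Real.sin θX * Real.cos θY * Real.cos θZ -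
      Complex.I * Complex.I * Real.cos θX * Real.sin θY * Real.sin θZ := by
    apply Complex.ext <;> simp [kakCoeff, -Complex.ofReal_cos, -Complex.ofReal_sin]
  have e2 : kakCoeff θX θY θZ 2 = Complex.I * Real.cos θX * Real.sin θY * Real.cos θZ -
      Complex.I * Complex.I * Real.sin θX * Real.cos θY * Real.sin θZ := by
    apply Complex.ext <;> simp [kakCoeff, -Complex.ofReal_cos, -Complex.ofReal_sin]
  have e3 : kakCoeff θX θY θZ 3 = Complex.I * Real.cos θX * Real.cos θY * Real.sin θZ -
      Complex.I * Complex.I * Real.sin θX * Real.sin θY * Real.cos θZ := by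
    apply Complex.ext <;> simp [kakCoeff, -Complex.ofReal_cos, -Complex.ofReal_sin]
  rw [e0, e1, e2, e3]
  simp only [add_mul, mul_add, Matrix.smul_mul, Matrix.mul_smul, Matrix.one_mul, Matrix.mul_one,
    hXY, hXZ, hYZ, hZZ, Matrix.neg_mul, smul_neg]
  module

theorem sum_norm_sq_kakCoeff (θX θY θZ : ℝ) : ∑ i, ‖kakCoeff θX θY θZ i‖ ^ 2 = 1 := by
  have hX := Real.sin_sq_add_cos_sq θX
  have hY := Real.sin_sq_add_cos_sq θY
  have hZ := Real.sin_sq_add_cos_sq θZ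
  simp only [Complex.sq_norm, Fin.sum_univ_four]
  simp only [kakCoeff, Complex.normSq_apply, Matrix.cons_val]
  have h : (Real.sin θX ^ 2 + Real.cos θX ^ 2) * (Real.sin θY ^ 2 + Real.cos θY ^ 2) *
    (Real.sin θZ ^ 2 + Real.cos θZ ^ 2) = 1 := by rw [hX, hY, hZ]; norm_num
  linear_combination h

theorem norm_complex_mk_zero_right (x : ℝ) : ‖(⟨x, 0⟩ : ℂ)‖ = |x| := by
  rw [← Real.norm_eq_abs, ← Complex.norm_real]
  rfl

theorem norm_complex_mk_zero_left (x : ℝ) : ‖(⟨0, x⟩ : ℂ)‖ = |x| := by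
  have : (⟨0, x⟩ : ℂ) = Complex.I * (x : ℂ) := by apply Complex.ext <;> simp
  rw [this, norm_mul, Complex.norm_I, one_mul, Complex.norm_real, Real.norm_eq_abs]

/-- For `θZ = 0` the sum factors as `(|sin θX| + |cos θX|) (|sin θY| + |cos θY|)`, and each square
is `1 + 2 |sin cos|`. At `π/4` all four moduli are `1/2` and both sides equal 7. -/
theorem two_mul_sum_norm_kakCoeff_sq_sub_one {θX θY θZ : ℝ}
    (hθ : θZ = 0 ∨ (θX = Real.pi / 4 ∧ θY = Real.pi / 4 ∧ θZ = Real.pi / 4)) :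
    2 * (∑ i, ‖kakCoeff θX θY θZ i‖) ^ 2 - 1 =
      1 + 4 * |Real.sin θX * Real.cos θX| + 4 * |Real.sin θY * Real.cos θY| +
          8 * |Real.sin θX * Real.cos θX * Real.sin θY * Real.cos θY| := by
  rcases hθ with rfl | ⟨rfl, rfl, rfl⟩
  · have hX : |Real.sin θX| ^ 2 + |Real.cos θX| ^ 2 = 1 := by
      rw [sq_abs, sq_abs, Real.sin_sq_add_cos_sq]
    have hY : |Real.sin θY| ^ 2 + |Real.cos θY| ^ 2 = 1 := by
      rw [sq_abs, sq_abs, Real.sin_sq_add_cos_sq]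
    simp only [Fin.sum_univ_four]
    simp only [kakCoeff, Matrix.cons_val, Real.sin_zero, Real.cos_zero, mul_zero, mul_one,
      norm_complex_mk_zero_left, norm_complex_mk_zero_right, abs_mul]
    generalize |Real.sin θX| = a at *
    generalize |Real.cos θX| = b at *
    generalize |Real.sin θY| = c at *
    generalize |Real.cos θY| = d at *
    linear_combination (2 * (c + d) ^ 2) * hX + (2 + 4 * a * b) * hY
  · have hsq : (Real.sqrt 2) ^ 2 = 2 := Real.sq_sqrt (by norm_num)
    have hn : ∀ i, ‖kakCoeff (Real.pi / 4) (Real.pi / 4) (Real.pi / 4) i‖ = 1 / 2 := by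
      intro i
      rw [← sq_eq_sq₀ (norm_nonneg _) (by norm_num), Complex.sq_norm]
      fin_cases i <;>
      · simp only [kakCoeff, Complex.normSq_apply, Real.sin_pi_div_four, Real.cos_pi_div_four,
          Matrix.cons_val, Fin.zero_eta, Fin.mk_one, Fin.reduceFinMk]
        linear_combination (Real.sqrt 2 ^ 4 + 2 * Real.sqrt 2 ^ 2 + 4) / 32 * hsq
    have hm : Real.sqrt 2 / 2 * (Real.sqrt 2 / 2) = 1 / 2 := by linear_combination hsq / 4
    simp only [hn, Real.sin_pi_div_four, Real.cos_pi_div_four, mul_assoc, hm]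
    norm_num

/-- Taking the phase from `arg` keeps it unimodular at `c = 0`, so an operator with zero coefficient
stays unitary. -/
theorem exists_norm_mul_phase (c : ℂ) : ∃ ω : ℂ, star ω * ω = 1 ∧ c = (‖c‖ : ℂ) * ω := by
  refine ⟨Complex.exp (c.arg * Complex.I), ?_, (Complex.norm_mul_exp_arg_mul_I c).symm⟩
  rw [Complex.star_def, ← Complex.normSq_eq_conj_mul_self, Complex.normSq_eq_norm_sq,
    Complex.norm_exp_ofReal_mul_I]
  simp

/-- Multiplication by the local unitaries preserves unitarity and Hilbert–Schmidt orthogonality of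
the Pauli basis. -/
theorem HasKAKAngles.exists_hasUnitarySchmidt {U : Matrix (Fin 2 × Fin 2) (Fin 2 × Fin 2) ℂ}
    {θX θY θZ : ℝ} (hU : HasKAKAngles U θX θY θZ) :
    ∃ L R, HasUnitarySchmidt U (fun i => ‖kakCoeff θX θY θZ i‖) L R := by
  obtain ⟨V₁, V₂, V₃, V₄, h₁, h₂, h₃, h₄, rfl⟩ := hU
  rw [exp_kak]
  have hc := sum_norm_sq_kakCoeff θX θY θZ
  generalize kakCoeff θX θY θZ = c at *
  choose ω hω hcω using fun i => exists_norm_mul_phase (c i)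
  rw [Matrix.mem_unitaryGroup_iff', Matrix.star_eq_conjTranspose] at h₁ h₂ h₃ h₄
  have h₃' : V₃ * V₃ᴴ = 1 := mul_eq_one_comm.1 h₃
  have h₄' : V₄ * V₄ᴴ = 1 := mul_eq_one_comm.1 h₄
  have hgram : ∀ {V W : Matrix (Fin 2) (Fin 2) ℂ} (i j : Fin 4), Vᴴ * V = 1 →
      (V * pauli i * W)ᴴ * (V * pauli j * W) = Wᴴ * ((pauli i)ᴴ * pauli j) * W := by
    intro V W i j hV
    simp only [Matrix.conjTranspose_mul, Matrix.mul_assoc]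
    rw [← Matrix.mul_assoc Vᴴ, hV, Matrix.one_mul]
  have horth : ∀ {V W : Matrix (Fin 2) (Fin 2) ℂ} (i j : Fin 4), Vᴴ * V = 1 → W * Wᴴ = 1 →
      ((V * pauli i * W)ᴴ * (V * pauli j * W)).trace = if i = j then 2 else 0 := by
    intro V W i j hV hW
    rw [hgram i j hV, Matrix.trace_mul_cycle, hW, Matrix.one_mul, pauli_orthogonal]
  have hunit : ∀ {V W : Matrix (Fin 2) (Fin 2) ℂ} (i : Fin 4), Vᴴ * V = 1 → Wᴴ * W = 1 →
      (V * pauli i * W)ᴴ * (V * pauli i * W) = 1 := by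
    intro V W i hV hW
    rw [hgram i i hV, pauli_conjTranspose_mul_self, Matrix.mul_one, hW]
  refine ⟨fun i => ω i • (V₁ * pauli i * V₃), fun i => V₂ * pauli i * V₄,
    fun i => norm_nonneg _, hc, fun i => ?_, fun i => hunit i h₂ h₄, fun i j => ?_,
    fun i j => horth i j h₂ h₄', ?_⟩
  · rw [Matrix.conjTranspose_smul, Matrix.smul_mul, Matrix.mul_smul, smul_smul, hω,
      hunit i h₁ h₃, one_smul]
  · rw [Matrix.conjTranspose_smul, Matrix.smul_mul, Matrix.mul_smul, smul_smul,
      Matrix.trace_smul, horth i j h₁ h₃']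
    split_ifs with hij
    · rw [hij, hω, one_smul]
    · rw [smul_zero]
  · rw [Finset.mul_sum, Finset.sum_mul]
    refine Finset.sum_congr rfl fun i _ => ?_
    rw [Matrix.mul_smul, Matrix.smul_mul, ← Matrix.mul_kronecker_mul, ← Matrix.mul_kronecker_mul,
      Matrix.smul_kronecker, smul_smul, ← hcω]

end CircuitKnitting
-- The γ-factors of the three classes
open CircuitKnitting

theorem theorem1 (U : Matrix (Fin 2 × Fin 2) (Fin 2 × Fin 2) ℂ) (θX θY θZ : ℝ)
    (hU : HasKAKAngles U θX θY θZ)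
    (hθ : θZ = 0 ∨ (θX = Real.pi / 4 ∧ θY = Real.pi / 4 ∧ θZ = Real.pi / 4))
    (R : ℕ∞) :
    -- the three γ-factors agree and have the stated value
    gammaFactor (LO 2 2 2 2) (unitaryChannel U) =
        gammaFactor (LOOneWayCC 2 2 2 2) (unitaryChannel U) ∧
    gammaFactor (LOOneWayCC 2 2 2 2) (unitaryChannel U) =
        gammaFactor (LOCC R 2 2 2 2) (unitaryChannel U) ∧
    gammaFactor (LOCC R 2 2 2 2) (unitaryChannel U) =
        1 + 4 * |Real.sin θX * Real.cos θX| + 4 * |Real.sin θY * Real.cos θY| +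
          8 * |Real.sin θX * Real.cos θX * Real.sin θY * Real.cos θY| ∧
    -- the minima that define them are attained
    gammaFactor (LO 2 2 2 2) (unitaryChannel U) ∈ qpdCosts (LO 2 2 2 2) (unitaryChannel U) ∧
    gammaFactor (LOOneWayCC 2 2 2 2) (unitaryChannel U) ∈
        qpdCosts (LOOneWayCC 2 2 2 2) (unitaryChannel U) ∧
    gammaFactor (LOCC R 2 2 2 2) (unitaryChannel U) ∈
        qpdCosts (LOCC R 2 2 2 2) (unitaryChannel U) ∧
    -- the value in terms of the Schmidt coefficients of the Choi state across AA' : BB'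
    (∃ (k : ℕ) (α : Fin k → ℝ) (e f : Fin k → EuclideanSpace ℂ (Fin 2 × Fin 2)),
      IsSchmidtDecomposition (choiState U) α e f) ∧
    ∀ (k : ℕ) (α : Fin k → ℝ) (e f : Fin k → EuclideanSpace ℂ (Fin 2 × Fin 2)),
      IsSchmidtDecomposition (choiState U) α e f →
        1 + 4 * |Real.sin θX * Real.cos θX| + 4 * |Real.sin θY * Real.cos θY| +
          8 * |Real.sin θX * Real.cos θX * Real.sin θY * Real.cos θY| =
        2 * (∑ i, α i) ^ 2 - 1 := by
  obtain ⟨L, K, h⟩ := hU.exists_hasUnitarySchmidt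
  have hval := two_mul_sum_norm_kakCoeff_sq_sub_one hθ
  have hLO := h.isLeast_qpdCosts (S := LO 2 2 2 2) subset_rfl
    fun _ => isSignedSeparable_of_mem_LO
  have hOne := h.isLeast_qpdCosts (LO_subset_LOOneWayCC 2 2 2 2)
    fun _ => isSignedSeparable_of_mem_LOOneWayCC
  -- Zero rounds already contain LO and the separable bound holds for any number of rounds, so the
  -- value is the same for every `R`.
  have hLOCC := h.isLeast_qpdCosts (LO_subset_LOCC R 2 2 2 2)
    fun _ hF => isSignedSeparable_of_mem_LOCCRounds hF.choose_spec.2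
  have gLO : gammaFactor (LO 2 2 2 2) (unitaryChannel U) = _ := hLO.csInf_eq
  have gOne : gammaFactor (LOOneWayCC 2 2 2 2) (unitaryChannel U) = _ := hOne.csInf_eq
  have gLOCC : gammaFactor (LOCC R 2 2 2 2) (unitaryChannel U) = _ := hLOCC.csInf_eq
  have hS := h.isSchmidtDecomposition
  rw [gLO, gOne, gLOCC]
  refine ⟨rfl, rfl, hval, hLO.1, hOne.1, hLOCC.1, ⟨_, _, _, _, hS⟩, fun k α e f hα => ?_⟩
  rw [← hval, le_antisymm (hS.sum_le hα) (hα.sum_le hS)]
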